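/- Let $r>2$ be a real number and put $\delta=\min(1,1/(r-2))\in(0,1]$. There is a finite constant $C$ depending only on $r$ such that the following holds. Let $(Z_i)_{i\in\mathbb Z}$ be a strictly stationary sequence of real random variables on a probability space, adapted to a filtration $(\mathcal G_i)_{i\in\mathbb Z}$ (that is, $\mathcal G_i\subseteq\mathcal G_{i+1}$ and $Z_i$ is $\mathcal G_i$-measurable for every $i\in\mathbb Z$), and let $S_i=\sum_{k=1}^{i}Z_k$. Then for every integer $N\ge 1$ and every real $x>0$, $$ \begin{aligned} \mathbb P\Bigl(\max_{1\le i\le N}|S_i|\ge x\Bigr)\le C\Biggl(&\frac{N}{x}\bigl\|\mathbb E(Z_2\mid\mathcal G_0)\bigr\|_1+\frac{N}{x^r}\,\mathbb E(|Z_1|^r)+\frac{N^{r/2}}{x^r}\bigl(\mathbb E(Z_1^2)\bigr)^{r/2}\\ &+\frac{N}{x^r}\Biggl[\sum_{k=1}^{N}\frac{1}{k^{1+2\delta/r}}\Bigl(\sum_{i=2}^{k}\bigl\|\mathbb E(Z_i^2\mid\mathcal G_0)-\mathbb E(Z_i^2)\bigr\|_{r/2}\Bigr)^{\delta}\Biggr]^{r/(2\delta)}\Biggr),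 \end{aligned} $$ where $\|\cdot\|_q$ denotes the $L^q$ norm on the probability space. (If $\mathbb E(|Z_1|^r)=\infty$, the right-hand side is $+\infty$ and the inequality is trivial.) -/

import Mathlib

open MeasureTheory ProbabilityTheory
open scoped ENNReal NNReal

/-- A two-sided real-valued process is strictly stationary if all its time shifts have the same law
(as random elements of `ℤ → ℝ` with the product σ-algebra) as the process itself. -/
def IsStrictlyStationary {Ω : Type*} [MeasurableSpace Ω] (Z : ℤ → Ω → ℝ) (μ : Measure Ω) : Prop :=
  ∀ k : ℤ, IdentDistrib (fun ω (i : ℤ) => Z (i + k) ω) (fun ω (i : ℤ) => Z i ω) μ μ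

/-- The partial sum `S_n = Z_1 + ⋯ + Z_n`. -/
def partialSum {Ω : Type*} (Z : ℤ → Ω → ℝ) (n : ℕ) (ω : Ω) : ℝ :=
  ∑ k ∈ Finset.Icc 1 n, Z (k : ℤ) ω

/-- The maximum of `|S_i|` over `0 ≤ i ≤ N`, where `S_0 = 0`; for `N ≥ 1` it is equal to the maximum
over `1 ≤ i ≤ N`. -/
noncomputable def maxAbsPartialSum {Ω : Type*} (Z : ℤ → Ω → ℝ) (N : ℕ) (ω : Ω) : ℝ :=
  (Finset.range (N + 1)).sup' Finset.nonempty_range_add_one (fun i => |partialSum Z i ω|)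

/-! Subtract from each `Z i` its conditional expectation given the past two steps back. By
stationarity every subtracted term has the L^1 norm of `E(Z 2 | past of 0)`, and Markov's inequality
turns their sum into the first term of the bound. The differences with odd indices and those with
even indices are two martingale difference sequences for every second σ-algebra, so Doob's
inequality reduces the maximum to an r-th moment at a dyadic time.

That moment is bounded by doubling. Let `x`, `y` be two consecutive blocks of length 2^j, both with
r-th moment at most U_j. In the expansion of |x+y|^r (`abs_add_rpow_le`) the linear term integrates
to zero, and the quadratic one is controlled by first conditioning y² on the past of `y`. The result
(`lintegral_add_rpow_le`) is U_{j+1} = 2 U_j + c U_j^{1-s} b_j^δ with s = 2δ/r, where b_j bounds the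
L^{r/2} norm of the conditional variance of a block. For (U_j / 2^j)^s this recursion is essentially
additive (`two_mul_add_rpow_le`), so U_K is at most 2^K times the 1/s-th power of a constant plus a
multiple of Σ 2^{-js} b_j^δ. Here b_j is 2^j E(Z_1²) plus the dependence coefficients up to index
2^j + 1. Subadditivity of t^δ separates the two: the variance gives a geometric sum, the
coefficients a dyadic sum comparable with the sum over all k (`exists_dyadic_bound_le`).

Stationarity concerns `Z` only, not the given filtration. The argument therefore runs in the natural
filtration; at the end the larger σ-algebra can only increase the norms
(`eLpNorm_condExp_sub_const_le`). -/

/-! ### Pointwise expansion of |x + y|^p. -/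

/-- Second-order expansion of `(1 + t) ^ p` for `|t| ≤ 1`. -/
theorem one_add_rpow_le_of_abs_le_one {p t : ℝ} (hp : 2 ≤ p) (ht : |t| ≤ 1) :
    (1 + t) ^ p ≤ 1 + p * t + p * (p - 1) * 2 ^ p * t ^ 2 := by
  obtain ⟨ht1, ht2⟩ := abs_le.1 ht
  have hu : 0 ≤ 1 + t := by linarith
  have h2p : (1 : ℝ) ≤ 2 ^ p := Real.one_le_rpow (by norm_num) (by linarith)
  rcases hu.eq_or_lt with h0 | hu
  · have : t = -1 := by linarith
    subst this
    rw [← h0, Real.zero_rpow (by linarith)]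
    nlinarith [mul_nonneg (show 0 ≤ p by linarith) (show 0 ≤ p - 1 by linarith)]
  -- Bernoulli's inequality at the reciprocal of u = 1 + t, multiplied by u^p, is an upper bound:
  -- u^p ≤ 1 + p t u^(p-1). No derivatives are needed.
  have key1 : (1 + t) ^ p ≤ 1 + p * t * (1 + t) ^ (p - 1) := by
    have hb := one_add_mul_self_le_rpow_one_add (s := (1 + t)⁻¹ - 1) (p := p)
      (by linarith [inv_pos.2 hu]) (by linarith)
    rw [add_sub_cancel, Real.inv_rpow hu.le] at hb
    have hpos : 0 < (1 + t) ^ p := Real.rpow_pos_of_pos hu _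
    have h := mul_le_mul_of_nonneg_right hb hpos.le
    rw [inv_mul_cancel₀ hpos.ne'] at h
    have hs : (1 + t) ^ p = (1 + t) ^ (p - 1) * (1 + t) := by
      rw [← Real.rpow_add_one hu.ne']; congr 1; ring
    have hi : ((1 + t)⁻¹ - 1) * (1 + t) ^ p = -t * (1 + t) ^ (p - 1) := by
      rw [hs]; field_simp; ring
    have : (1 + p * ((1 + t)⁻¹ - 1)) * (1 + t) ^ p
        = (1 + t) ^ p + p * (((1 + t)⁻¹ - 1) * (1 + t) ^ p) := by ring
    rw [this, hi] at h
    linarith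
  have lower : 1 + (p - 1) * t ≤ (1 + t) ^ (p - 1) :=
    one_add_mul_self_le_rpow_one_add (by linarith) (by linarith)
  have hpp : 0 ≤ p * (p - 1) := mul_nonneg (by linarith) (by linarith)
  -- It remains to bound t u^(p-1) from above: for t ≤ 0 the lower Bernoulli bound on u^(p-1)
  -- suffices, for t ≥ 0 the reciprocal trick is repeated with u^(p-2) ≤ 2^p.
  rcases le_total t 0 with htn | htp
  · have h1 : t * (1 + t) ^ (p - 1) ≤ t * (1 + (p - 1) * t) :=
      mul_le_mul_of_nonpos_left lower htn
    have h2 : p * (t * (1 + t) ^ (p - 1)) ≤ p * (t * (1 + (p - 1) * t)) :=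
      mul_le_mul_of_nonneg_left h1 (by linarith)
    nlinarith [mul_le_mul_of_nonneg_left h2p (mul_nonneg hpp (sq_nonneg t))]
  · have upper : (1 + t) ^ (p - 1) ≤ 1 + (p - 1) * t * (1 + t) ^ (p - 2) := by
      have hb := one_add_mul_self_le_rpow_one_add (s := (1 + t)⁻¹ - 1) (p := p - 1)
        (by linarith [inv_pos.2 hu]) (by linarith)
      rw [add_sub_cancel, Real.inv_rpow hu.le] at hb
      have hpos : 0 < (1 + t) ^ (p - 1) := Real.rpow_pos_of_pos hu _
      have h := mul_le_mul_of_nonneg_right hb hpos.le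
      rw [inv_mul_cancel₀ hpos.ne'] at h
      have hs : (1 + t) ^ (p - 1) = (1 + t) ^ (p - 2) * (1 + t) := by
        rw [← Real.rpow_add_one hu.ne']; congr 1; ring
      have hi : ((1 + t)⁻¹ - 1) * (1 + t) ^ (p - 1) = -t * (1 + t) ^ (p - 2) := by
        rw [hs]; field_simp; ring
      have : (1 + (p - 1) * ((1 + t)⁻¹ - 1)) * (1 + t) ^ (p - 1)
          = (1 + t) ^ (p - 1) + (p - 1) * (((1 + t)⁻¹ - 1) * (1 + t) ^ (p - 1)) := by ring
      rw [this, hi] at h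
      linarith
    have hle : (1 + t) ^ (p - 2) ≤ 2 ^ p :=
      (Real.rpow_le_rpow hu.le (by linarith) (by linarith)).trans
        (Real.rpow_le_rpow_of_exponent_le (by norm_num) (by linarith))
    have h1 : (1 + t) ^ (p - 1) ≤ 1 + (p - 1) * t * 2 ^ p :=
      upper.trans (by
        have := mul_le_mul_of_nonneg_left hle (mul_nonneg (show 0 ≤ p - 1 by linarith) htp)
        linarith)
    have h2 := mul_le_mul_of_nonneg_left h1 (mul_nonneg (show 0 ≤ p by linarith) htp)
    nlinarith

/-- First-order bound of `(1 + t) ^ p` for `0 ≤ t ≤ 1`. -/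
theorem one_add_rpow_le_one_add_mul {p t : ℝ} (hp : 2 ≤ p) (h0 : 0 ≤ t) (h1 : t ≤ 1) :
    (1 + t) ^ p ≤ 1 + (p + p * (p - 1) * 2 ^ p) * t := by
  have h := one_add_rpow_le_of_abs_le_one hp (abs_le.2 ⟨by linarith, h1⟩)
  have : p * (p - 1) * 2 ^ p * t ^ 2 ≤ p * (p - 1) * 2 ^ p * t :=
    mul_le_mul_of_nonneg_left (by nlinarith)
      (mul_nonneg (mul_nonneg (by linarith) (by linarith)) (by positivity))
  linarith

theorem abs_rpow_sub_two_mul_sq {p : ℝ} (hp : 2 < p) (x : ℝ) :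
    |x| ^ (p - 2) * x ^ 2 = |x| ^ p := by
  rcases eq_or_ne x 0 with rfl | hx
  · simp [Real.zero_rpow (show p ≠ 0 by linarith)]
  · rw [← sq_abs, ← Real.rpow_two, ← Real.rpow_add (abs_pos.2 hx)]
    congr 1; ring

/-- The constant in `abs_add_rpow_le`. -/
noncomputable def rosenthalConst (p : ℝ) : ℝ := 2 * p + p * (p - 1) * 2 ^ p

theorem rosenthalConst_nonneg {p : ℝ} (hp : 2 < p) : 0 ≤ rosenthalConst p :=
  add_nonneg (by linarith)
    (mul_nonneg (mul_nonneg (by linarith) (by linarith)) (by positivity))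

/-- For |y| ≤ |x| this is the second-order expansion in y/x. For |x| < |y| the expansion in t =
|x|/|y| has a first-order error |y|^p t, which the interpolated term absorbs; this is why that term
is present and why δ(p-2) ≤ 1 is required. -/
theorem abs_add_rpow_le {p δ : ℝ} (hp : 2 < p) (hδ : δ ∈ Set.Ioc (0 : ℝ) 1)
    (hpδ : δ * (p - 2) ≤ 1) (x y : ℝ) :
    |x + y| ^ p ≤ |x| ^ p + p * (|x| ^ (p - 2) * x * y) + |y| ^ p
      + rosenthalConst p * (|x| ^ (p - 2) * y ^ 2
        + (|x| ^ (p - 2) * y ^ 2) ^ δ * (|y| ^ p) ^ (1 - δ)) := by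
  have hC := rosenthalConst_nonneg hp
  have hpp : 0 ≤ p * (p - 1) * 2 ^ p :=
    mul_nonneg (mul_nonneg (by linarith) (by linarith)) (by positivity)
  have hw : 0 ≤ |x| ^ (p - 2) * y ^ 2 := by positivity
  have hw' : 0 ≤ (|x| ^ (p - 2) * y ^ 2) ^ δ * (|y| ^ p) ^ (1 - δ) := by positivity
  have hy : 0 ≤ |y| ^ p := by positivity
  rcases le_or_gt |y| |x| with hle | hlt
  · rcases eq_or_ne x 0 with rfl | hx
    · have : y = 0 := by simpa using hle
      subst this
      simp [Real.zero_rpow (show p ≠ 0 by linarith), Real.zero_rpow (show p - 2 ≠ 0 by linarith),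
        Real.zero_rpow (hδ.1.ne')]
    set t := y / x with ht
    have hyt : y = x * t := by rw [ht]; field_simp
    have ht1 : |t| ≤ 1 := by
      rw [ht, abs_div]; exact div_le_one_of_le₀ hle (abs_nonneg _)
    have h1 : 0 ≤ 1 + t := by linarith [(abs_le.1 ht1).1]
    have e1 : |x + y| ^ p = |x| ^ p * (1 + t) ^ p := by
      rw [hyt, show x + x * t = x * (1 + t) by ring, abs_mul, abs_of_nonneg h1,
        Real.mul_rpow (abs_nonneg _) h1]
    have e2 : |x| ^ (p - 2) * x * y = |x| ^ p * t := by
      rw [← abs_rpow_sub_two_mul_sq hp x, hyt]; ring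
    have e3 : |x| ^ (p - 2) * y ^ 2 = |x| ^ p * t ^ 2 := by
      rw [← abs_rpow_sub_two_mul_sq hp x, hyt]; ring
    have hxp : 0 ≤ |x| ^ p := by positivity
    have key := mul_le_mul_of_nonneg_left (one_add_rpow_le_of_abs_le_one hp.le ht1) hxp
    have hc : p * (p - 1) * 2 ^ p * (|x| ^ (p - 2) * y ^ 2)
        ≤ rosenthalConst p * (|x| ^ (p - 2) * y ^ 2) :=
      mul_le_mul_of_nonneg_right (by unfold rosenthalConst; linarith) hw
    have := mul_nonneg hC hw'
    rw [e1, e2, mul_add]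
    rw [e3] at hc ⊢
    rw [e3] at this
    nlinarith
  · have hy0 : 0 < |y| := (abs_nonneg x).trans_lt hlt
    set t := |x| / |y| with ht
    have hxt : |x| = |y| * t := by rw [ht]; field_simp
    have ht0 : 0 ≤ t := by positivity
    have ht1 : t ≤ 1 := div_le_one_of_le₀ hlt.le (abs_nonneg _)
    have e1 : |x + y| ^ p ≤ |y| ^ p * (1 + t) ^ p := by
      rw [← Real.mul_rpow (abs_nonneg _) (by linarith)]
      refine Real.rpow_le_rpow (abs_nonneg _) ?_ (by linarith)
      calc |x + y| ≤ |x| + |y| := abs_add_le _ _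
        _ = |y| * (1 + t) := by rw [hxt]; ring
    have key := mul_le_mul_of_nonneg_left (one_add_rpow_le_one_add_mul hp.le ht0 ht1) hy
    -- The linear term may be negative here; compensating it costs p, and the first-order expansion
    -- costs another p, hence the 2p in `rosenthalConst`.
    have e2 : -(|y| ^ p * t) ≤ |x| ^ (p - 2) * x * y := by
      have hA : |(|x| ^ (p - 2) * x * y)| ≤ |y| ^ p * t := by
        rw [abs_mul, abs_mul, abs_of_nonneg (show 0 ≤ |x| ^ (p - 2) by positivity)]
        calc |x| ^ (p - 2) * |x| * |y| ≤ |y| ^ (p - 2) * |x| * |y| := by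
              gcongr
          _ = |y| ^ (p - 2) * y ^ 2 * t := by rw [hxt, ← sq_abs y]; ring
          _ = |y| ^ p * t := by rw [abs_rpow_sub_two_mul_sq hp]
      exact (abs_le.1 hA).1
    have e3 : |y| ^ p * t ≤ (|x| ^ (p - 2) * y ^ 2) ^ δ * (|y| ^ p) ^ (1 - δ) := by
      have e : |x| ^ (p - 2) * y ^ 2 = |y| ^ p * t ^ (p - 2) := by
        rw [hxt, Real.mul_rpow (abs_nonneg _) ht0, ← abs_rpow_sub_two_mul_sq hp y]; ring
      have hyp : 0 < |y| ^ p := Real.rpow_pos_of_pos hy0 _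
      rw [e, Real.mul_rpow hy (by positivity), mul_right_comm, ← Real.rpow_add hyp,
        ← Real.rpow_mul ht0]
      simp only [add_sub_cancel, Real.rpow_one]
      refine mul_le_mul_of_nonneg_left ?_ hy
      rcases ht0.eq_or_lt with h | h
      · rw [← h]; positivity
      · calc t = t ^ (1 : ℝ) := (Real.rpow_one t).symm
          _ ≤ _ := Real.rpow_le_rpow_of_exponent_ge h ht1 (by linarith)
    have hx : 0 ≤ |x| ^ p := by positivity
    have := mul_nonneg hC hw
    have h3 := mul_le_mul_of_nonneg_left e3 hC
    have h2 := mul_le_mul_of_nonneg_left e2 (show 0 ≤ p by linarith)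
    have h4 : rosenthalConst p * (|y| ^ p * t)
      = 2 * p * (|y| ^ p * t) + p * (p - 1) * 2 ^ p * (|y| ^ p * t) := by
      unfold rosenthalConst; ring
    rw [mul_add (rosenthalConst p)]
    nlinarith

/-- Replacing both bases by the larger one gives a domination strong enough for the integrability of
every mixed product below. -/
theorem rpow_mul_rpow_le_add {a b α β p : ℝ} (ha : 0 ≤ a) (hb : 0 ≤ b) (hα : 0 ≤ α) (hβ : 0 ≤ β)
    (hαβ : α + β = p) : a ^ α * b ^ β ≤ a ^ p + b ^ p := by
  rcases le_total a b with h | h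
  · calc a ^ α * b ^ β ≤ b ^ α * b ^ β := by gcongr
      _ = b ^ p := by rw [← Real.rpow_add_of_nonneg hb hα hβ, hαβ]
      _ ≤ _ := le_add_of_nonneg_left (by positivity)
  · calc a ^ α * b ^ β ≤ a ^ α * a ^ β := by gcongr
      _ = a ^ p := by rw [← Real.rpow_add_of_nonneg ha hα hβ, hαβ]
      _ ≤ _ := le_add_of_nonneg_right (by positivity)

/-! ### Moment of a sum of two consecutive blocks. -/

section

variable {Ω : Type*} {m mΩ : MeasurableSpace Ω} {μ : Measure Ω}

theorem MeasureTheory.MemLp.integrable_abs_rpow {p : ℝ} (hp : 0 < p) {x : Ω → ℝ}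
    (hx : MemLp x (ENNReal.ofReal p) μ) : Integrable (fun ω => |x ω| ^ p) μ := by
  have := hx.integrable_norm_rpow (by simpa using hp) ENNReal.ofReal_ne_top
  simpa [ENNReal.toReal_ofReal hp.le] using this

theorem integrable_abs_rpow_mul_abs_rpow {p α β : ℝ} (hp : 0 < p) (hα : 0 ≤ α) (hβ : 0 ≤ β)
    (hαβ : α + β = p) {x y : Ω → ℝ} (hx : MemLp x (ENNReal.ofReal p) μ)
    (hy : MemLp y (ENNReal.ofReal p) μ) :
    Integrable (fun ω => |x ω| ^ α * |y ω| ^ β) μ := by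
  refine ((hx.integrable_abs_rpow hp).add (hy.integrable_abs_rpow hp)).mono' ?_ ?_
  · exact ((hx.1.aemeasurable.abs.pow_const _).mul
      (hy.1.aemeasurable.abs.pow_const _)).aestronglyMeasurable
  · refine Filter.Eventually.of_forall fun ω => ?_
    rw [Real.norm_of_nonneg (by positivity)]
    exact rpow_mul_rpow_le_add (abs_nonneg _) (abs_nonneg _) hα hβ hαβ

theorem integral_mul_eq_zero_of_condExp_eq_zero [IsFiniteMeasure μ] (hm : m ≤ mΩ) {f g : Ω → ℝ}
    (hf : StronglyMeasurable[m] f) (hfg : Integrable (fun ω => f ω * g ω) μ) (hg : Integrable g μ)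
    (h0 : μ[g | m] =ᵐ[μ] 0) : ∫ ω, f ω * g ω ∂μ = 0 := by
  have h := condExp_mul_of_stronglyMeasurable_left hf hfg hg
  rw [← integral_condExp hm (f := fun ω => f ω * g ω)]
  refine integral_eq_zero_of_ae ?_
  filter_upwards [h, h0] with ω h1 h2
  have : (μ[fun ω => f ω * g ω | m]) ω = f ω * (μ[g | m]) ω := h1
  simp [this, h2]

theorem lintegral_enorm_rpow_mul_sq_le {p : ℝ} (hp : 2 < p) {x y : Ω → ℝ}
    (hx : AEMeasurable x μ) (hy : AEMeasurable y μ) {U : ℝ≥0∞}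
    (hxU : ∫⁻ ω, ‖x ω‖ₑ ^ p ∂μ ≤ U) (hyU : ∫⁻ ω, ‖y ω‖ₑ ^ p ∂μ ≤ U) :
    ∫⁻ ω, ‖x ω‖ₑ ^ (p - 2) * ‖y ω‖ₑ ^ (2 : ℝ) ∂μ ≤ U := by
  have hp0 : p ≠ 0 := by linarith
  have e : (p - 2) / p + 2 / p = 1 := by field_simp; ring
  have h1 : 0 ≤ (p - 2) / p := div_nonneg (by linarith) (by linarith)
  have h2 : 0 ≤ 2 / p := div_nonneg (by linarith) (by linarith)
  have h := ENNReal.lintegral_mul_norm_pow_le (μ := μ) (hx.enorm.pow_const p)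
    (hy.enorm.pow_const p) h1 h2 e
  simp only [← ENNReal.rpow_mul, mul_div_cancel₀ _ hp0] at h
  calc _ ≤ _ := h
    _ ≤ U ^ ((p - 2) / p) * U ^ (2 / p) := by gcongr
    _ = U := by rw [← ENNReal.rpow_add_of_nonneg _ _ h1 h2, e, ENNReal.rpow_one]

/-- The factor in `x` is `m`-measurable, so y² may be replaced by its conditional expectation before
Hölder's inequality with weights (p-2)/p and 2/p. The gain over direct Hölder is that only the
conditional variance of `y` enters, not its p-th moment. -/
theorem lintegral_enorm_rpow_mul_sq_le_condExp [IsFiniteMeasure μ] (hm : m ≤ mΩ) {p : ℝ}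
    (hp : 2 < p) {x y : Ω → ℝ} (hxm : StronglyMeasurable[m] x)
    (hx : MemLp x (ENNReal.ofReal p) μ) (hy : MemLp y (ENNReal.ofReal p) μ) :
    ∫⁻ ω, ‖x ω‖ₑ ^ (p - 2) * ‖y ω‖ₑ ^ (2 : ℝ) ∂μ
      ≤ (∫⁻ ω, ‖x ω‖ₑ ^ p ∂μ) ^ ((p - 2) / p)
        * eLpNorm (μ[fun ω => y ω ^ 2 | m]) (ENNReal.ofReal (p / 2)) μ := by
  have hp0 : p ≠ 0 := by linarith
  have e : (p - 2) / p + 2 / p = 1 := by field_simp; ring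
  have h1 : 0 ≤ (p - 2) / p := div_nonneg (by linarith) (by linarith)
  have h2 : 0 ≤ 2 / p := div_nonneg (by linarith) (by linarith)
  have hint : Integrable (fun ω => |x ω| ^ (p - 2) * y ω ^ 2) μ := by
    have := integrable_abs_rpow_mul_abs_rpow (p := p) (α := p - 2) (β := 2) (by linarith)
      (by linarith) (by norm_num) (by ring) hx hy
    simpa [Real.rpow_two, sq_abs] using this
  have hy2 : Integrable (fun ω => y ω ^ 2) μ := by
    refine (hy.mono_exponent (p := 2) ?_).integrable_sq
    rw [show (2 : ℝ≥0∞) = ENNReal.ofReal 2 by simp]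
    exact ENNReal.ofReal_le_ofReal hp.le
  have hxm' : StronglyMeasurable[m] (fun ω => |x ω| ^ (p - 2)) :=
    ((measurable_id.abs.pow_const (p - 2)).comp hxm.measurable).stronglyMeasurable
  have hpull := condExp_mul_of_stronglyMeasurable_left (f := fun ω => |x ω| ^ (p - 2)) hxm' hint hy2
  have hEm : AEMeasurable (μ[fun ω => y ω ^ 2 | m]) μ :=
    (stronglyMeasurable_condExp.mono hm).measurable.aemeasurable
  have e1 : ∫⁻ ω, ‖x ω‖ₑ ^ (p - 2) * ‖y ω‖ₑ ^ (2 : ℝ) ∂μ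
      = ENNReal.ofReal (∫ ω, |x ω| ^ (p - 2) * y ω ^ 2 ∂μ) := by
    rw [ofReal_integral_eq_lintegral_ofReal hint
      (Filter.Eventually.of_forall fun ω => by positivity)]
    refine lintegral_congr fun ω => ?_
    rw [ENNReal.ofReal_mul (by positivity), ← ENNReal.ofReal_rpow_of_nonneg (abs_nonneg _)
      (by linarith), ← sq_abs, ENNReal.ofReal_pow (abs_nonneg _), ENNReal.rpow_two,
      ← Real.norm_eq_abs, ← Real.norm_eq_abs, ofReal_norm, ofReal_norm]
  rw [e1, ← integral_condExp hm]
  calc ENNReal.ofReal (∫ ω, (μ[fun ω => |x ω| ^ (p - 2) * y ω ^ 2 | m]) ω ∂μ)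
      ≤ ∫⁻ ω, ‖(μ[fun ω => |x ω| ^ (p - 2) * y ω ^ 2 | m]) ω‖ₑ ∂μ := by
        refine (ENNReal.ofReal_le_ofReal (le_abs_self _)).trans ?_
        rw [← Real.norm_eq_abs, ofReal_norm]
        exact enorm_integral_le_lintegral_enorm _
    _ = ∫⁻ ω, ‖x ω‖ₑ ^ (p - 2) * ‖(μ[fun ω => y ω ^ 2 | m]) ω‖ₑ ∂μ := by
        refine lintegral_congr_ae ?_
        filter_upwards [hpull] with ω hω
        have : (μ[fun ω => |x ω| ^ (p - 2) * y ω ^ 2 | m]) ω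
          = |x ω| ^ (p - 2) * (μ[fun ω => y ω ^ 2 | m]) ω := hω
        rw [this, enorm_mul, Real.enorm_rpow_of_nonneg (abs_nonneg _) (by linarith),
          Real.enorm_abs]
    _ ≤ _ := by
        have h := ENNReal.lintegral_mul_norm_pow_le (μ := μ)
          (hx.1.aemeasurable.enorm.pow_const p)
          (hEm.enorm.pow_const (p / 2)) h1 h2 e
        simp only [← ENNReal.rpow_mul, mul_div_cancel₀ _ hp0] at h
        rw [eLpNorm_eq_lintegral_rpow_enorm_toReal (by simp; linarith) ENNReal.ofReal_ne_top,
          ENNReal.toReal_ofReal (by linarith)]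
        have e3 : p / 2 * (2 / p) = 1 := by field_simp
        have e4 : 1 / (p / 2) = 2 / p := by field_simp
        simp only [e3, ENNReal.rpow_one] at h
        rw [e4]
        exact h

/-- One doubling step for the `p`-th moment: `x` is the first half of a martingale and `y` its
second half. -/
theorem lintegral_add_rpow_le [IsFiniteMeasure μ] (hm : m ≤ mΩ) {p δ : ℝ} (hp : 2 < p)
    (hδ : δ ∈ Set.Ioc (0 : ℝ) 1) (hpδ : δ * (p - 2) ≤ 1) {x y : Ω → ℝ}
    (hxm : StronglyMeasurable[m] x) (hx : MemLp x (ENNReal.ofReal p) μ)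
    (hy : MemLp y (ENNReal.ofReal p) μ) (hy0 : μ[y | m] =ᵐ[μ] 0) {U b : ℝ≥0∞}
    (hxU : ∫⁻ ω, ‖x ω‖ₑ ^ p ∂μ ≤ U) (hyU : ∫⁻ ω, ‖y ω‖ₑ ^ p ∂μ ≤ U)
    (hb : eLpNorm (μ[fun ω => y ω ^ 2 | m]) (ENNReal.ofReal (p / 2)) μ ≤ b) :
    ∫⁻ ω, ‖x ω + y ω‖ₑ ^ p ∂μ
      ≤ 2 * U + ENNReal.ofReal (2 * rosenthalConst p) * (U ^ (1 - 2 * δ / p) * b ^ δ) := by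
  have hp0 : 0 < p := by linarith
  have hC := rosenthalConst_nonneg hp
  have h1δ : 0 ≤ 1 - δ := by linarith [hδ.2]
  have hy1 : Integrable y μ := hy.integrable (by
    rw [show (1 : ℝ≥0∞) = ENNReal.ofReal 1 by simp]; exact ENNReal.ofReal_le_ofReal (by linarith))
  have i1 := hx.integrable_abs_rpow hp0
  have i2 := hy.integrable_abs_rpow hp0
  have i3 := integrable_abs_rpow_mul_abs_rpow (p := p) (α := p - 2) (β := 2) hp0
    (by linarith) (by norm_num) (by ring) hx hy
  simp only [Real.rpow_two, sq_abs] at i3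
  have i4 : Integrable (fun ω => (|x ω| ^ (p - 2) * y ω ^ 2) ^ δ * (|y ω| ^ p) ^ (1 - δ)) μ := by
    refine (i3.add i2).mono' ?_ ?_
    · exact ((i3.1.aemeasurable.pow_const _).mul
        (i2.1.aemeasurable.pow_const _)).aestronglyMeasurable
    · refine Filter.Eventually.of_forall fun ω => ?_
      rw [Real.norm_of_nonneg (by positivity)]
      have := rpow_mul_rpow_le_add (a := |x ω| ^ (p - 2) * y ω ^ 2) (b := |y ω| ^ p) (p := 1)
        (by positivity) (by positivity) hδ.1.le h1δ (by ring)
      simpa using this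
  have i5 : Integrable (fun ω => |x ω| ^ (p - 2) * x ω * y ω) μ := by
    have h := integrable_abs_rpow_mul_abs_rpow (p := p) (α := p - 1) (β := 1) hp0
      (by linarith) (by norm_num) (by ring) hx hy
    refine h.mono' ?_ ?_
    · exact (((hx.1.aemeasurable.abs.pow_const _).mul hx.1.aemeasurable).mul
        hy.1.aemeasurable).aestronglyMeasurable
    · refine Filter.Eventually.of_forall fun ω => ?_
      rw [norm_mul, norm_mul, Real.norm_of_nonneg (by positivity), Real.norm_eq_abs,
        Real.norm_eq_abs, Real.rpow_one]
      refine mul_le_mul_of_nonneg_right (le_of_eq ?_) (abs_nonneg _)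
      rw [← Real.rpow_add_one' (abs_nonneg _) (by linarith)]
      congr 1; ring
  have i6 : Integrable (fun ω => |x ω + y ω| ^ p) μ := (hx.add hy).integrable_abs_rpow hp0
  have i7 : Integrable (fun ω => |x ω| ^ p + |y ω| ^ p
      + rosenthalConst p * (|x ω| ^ (p - 2) * y ω ^ 2
        + (|x ω| ^ (p - 2) * y ω ^ 2) ^ δ * (|y ω| ^ p) ^ (1 - δ))) μ :=
    (i1.add i2).add ((i3.add i4).const_mul _)
  -- The only signed term of the expansion disappears because `y` has zero conditional mean given
  -- the σ-algebra of `x`.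
  have hz : ∫ ω, |x ω| ^ (p - 2) * x ω * y ω ∂μ = 0 :=
    integral_mul_eq_zero_of_condExp_eq_zero hm
      (((measurable_id.abs.pow_const (p - 2)).mul measurable_id).comp
        hxm.measurable).stronglyMeasurable i5 hy1 hy0
  have hmain : ∫ ω, |x ω + y ω| ^ p ∂μ
      ≤ ∫ ω, (|x ω| ^ p + |y ω| ^ p + rosenthalConst p * (|x ω| ^ (p - 2) * y ω ^ 2
        + (|x ω| ^ (p - 2) * y ω ^ 2) ^ δ * (|y ω| ^ p) ^ (1 - δ))) ∂μ := by
    have h : ∫ ω, |x ω + y ω| ^ p ∂μ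
      ≤ ∫ ω, ((|x ω| ^ p + |y ω| ^ p + rosenthalConst p * (|x ω| ^ (p - 2) * y ω ^ 2
        + (|x ω| ^ (p - 2) * y ω ^ 2) ^ δ * (|y ω| ^ p) ^ (1 - δ)))
          + p * (|x ω| ^ (p - 2) * x ω * y ω)) ∂μ := by
      refine integral_mono i6 (i7.add (i5.const_mul _)) fun ω => ?_
      have := abs_add_rpow_le hp hδ hpδ (x ω) (y ω)
      simp only
      linarith
    rw [integral_add i7 (i5.const_mul _),
      integral_const_mul, hz] at h
    simpa using h
  have eL : ∫⁻ ω, ‖x ω + y ω‖ₑ ^ p ∂μ = ENNReal.ofReal (∫ ω, |x ω + y ω| ^ p ∂μ) := by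
    rw [ofReal_integral_eq_lintegral_ofReal i6 (Filter.Eventually.of_forall fun ω => by positivity)]
    refine lintegral_congr fun ω => ?_
    rw [← ENNReal.ofReal_rpow_of_nonneg (abs_nonneg _) hp0.le, ← Real.norm_eq_abs, ofReal_norm]
  have eW : ∀ ω, ENNReal.ofReal (|x ω| ^ (p - 2) * y ω ^ 2)
      = ‖x ω‖ₑ ^ (p - 2) * ‖y ω‖ₑ ^ (2 : ℝ) := fun ω => by
    rw [ENNReal.ofReal_mul (by positivity), ← ENNReal.ofReal_rpow_of_nonneg (abs_nonneg _)
      (by linarith), ← sq_abs, ENNReal.ofReal_pow (abs_nonneg _), ENNReal.rpow_two,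
      ← Real.norm_eq_abs, ← Real.norm_eq_abs, ofReal_norm, ofReal_norm]
  have eP : ∀ z : ℝ, ENNReal.ofReal (|z| ^ p) = ‖z‖ₑ ^ p := fun z => by
    rw [← ENNReal.ofReal_rpow_of_nonneg (abs_nonneg _) hp0.le, ← Real.norm_eq_abs, ofReal_norm]
  have hax := hx.1.aemeasurable
  have hay := hy.1.aemeasurable
  set W := ∫⁻ ω, ‖x ω‖ₑ ^ (p - 2) * ‖y ω‖ₑ ^ (2 : ℝ) ∂μ with hW
  have hWm : AEMeasurable (fun ω => ‖x ω‖ₑ ^ (p - 2) * ‖y ω‖ₑ ^ (2 : ℝ)) μ :=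
    (hax.enorm.pow_const _).mul (hay.enorm.pow_const _)
  have hW1 : W ≤ U := lintegral_enorm_rpow_mul_sq_le hp hax hay hxU hyU
  have hW2 : W ≤ U ^ ((p - 2) / p) * b :=
    (lintegral_enorm_rpow_mul_sq_le_condExp hm hp hxm hx hy).trans (by
      gcongr)
  -- The power of U is δ(p-2)/p + (1-δ) = 1 - 2δ/p.
  have hWU : W ^ δ * U ^ (1 - δ) ≤ U ^ (1 - 2 * δ / p) * b ^ δ := by
    calc W ^ δ * U ^ (1 - δ) ≤ (U ^ ((p - 2) / p) * b) ^ δ * U ^ (1 - δ) := by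
          gcongr; exact hδ.1.le
      _ = U ^ (1 - 2 * δ / p) * b ^ δ := by
          rw [ENNReal.mul_rpow_of_nonneg _ _ hδ.1.le, ← ENNReal.rpow_mul, mul_right_comm,
            ← ENNReal.rpow_add_of_nonneg _ _
              (mul_nonneg (div_nonneg (by linarith) hp0.le) hδ.1.le) h1δ]
          congr 2
          field_simp; ring
  -- The pure quadratic term is put in the same form as the interpolated one: write W = W^δ W^(1-δ)
  -- and use W ≤ U in the second factor only.
  have hWle : W ≤ U ^ (1 - 2 * δ / p) * b ^ δ := by
    refine le_trans ?_ hWU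
    calc W = W ^ δ * W ^ (1 - δ) := by
          rw [← ENNReal.rpow_add_of_nonneg _ _ hδ.1.le h1δ]; simp
      _ ≤ _ := by gcongr
  have hW' : ∫⁻ ω, (‖x ω‖ₑ ^ (p - 2) * ‖y ω‖ₑ ^ (2 : ℝ)) ^ δ * (‖y ω‖ₑ ^ p) ^ (1 - δ) ∂μ
      ≤ U ^ (1 - 2 * δ / p) * b ^ δ := by
    refine (ENNReal.lintegral_mul_norm_pow_le hWm (hay.enorm.pow_const p) hδ.1.le h1δ
      (by ring)).trans (le_trans ?_ hWU)
    gcongr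
  rw [eL]
  refine (ENNReal.ofReal_le_ofReal hmain).trans ?_
  rw [ofReal_integral_eq_lintegral_ofReal i7
    (Filter.Eventually.of_forall fun ω => by simp only [Pi.zero_apply]; positivity)]
  have e : ∀ ω, ENNReal.ofReal (|x ω| ^ p + |y ω| ^ p
      + rosenthalConst p * (|x ω| ^ (p - 2) * y ω ^ 2
        + (|x ω| ^ (p - 2) * y ω ^ 2) ^ δ * (|y ω| ^ p) ^ (1 - δ)))
      = ‖x ω‖ₑ ^ p + ‖y ω‖ₑ ^ p + ENNReal.ofReal (rosenthalConst p)
        * (‖x ω‖ₑ ^ (p - 2) * ‖y ω‖ₑ ^ (2 : ℝ)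
          + (‖x ω‖ₑ ^ (p - 2) * ‖y ω‖ₑ ^ (2 : ℝ)) ^ δ * (‖y ω‖ₑ ^ p) ^ (1 - δ)) := fun ω => by
    rw [ENNReal.ofReal_add (by positivity) (by positivity),
      ENNReal.ofReal_add (by positivity) (by positivity), ENNReal.ofReal_mul hC,
      ENNReal.ofReal_add (by positivity) (by positivity), ENNReal.ofReal_mul
        (p := (|x ω| ^ (p - 2) * y ω ^ 2) ^ δ) (by positivity),
      ← ENNReal.ofReal_rpow_of_nonneg (by positivity) hδ.1.le,
      ← ENNReal.ofReal_rpow_of_nonneg (p := 1 - δ) (by positivity) h1δ, eW, eP, eP]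
  have hxy : AEMeasurable (fun ω => ‖x ω‖ₑ ^ p + ‖y ω‖ₑ ^ p) μ :=
    (hax.enorm.pow_const p).add (hay.enorm.pow_const p)
  have hWW : AEMeasurable (fun ω => ‖x ω‖ₑ ^ (p - 2) * ‖y ω‖ₑ ^ (2 : ℝ)
      + (‖x ω‖ₑ ^ (p - 2) * ‖y ω‖ₑ ^ (2 : ℝ)) ^ δ * (‖y ω‖ₑ ^ p) ^ (1 - δ)) μ :=
    hWm.add ((hWm.pow_const _).mul ((hay.enorm.pow_const p).pow_const _))
  rw [lintegral_congr e, lintegral_add_left' hxy,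
    lintegral_add_left' (hax.enorm.pow_const p), lintegral_const_mul'' _ hWW, lintegral_add_left' hWm]
  calc _ ≤ U + U + ENNReal.ofReal (rosenthalConst p)
        * (U ^ (1 - 2 * δ / p) * b ^ δ + U ^ (1 - 2 * δ / p) * b ^ δ) := by gcongr
    _ = _ := by rw [ENNReal.ofReal_mul (by norm_num), ENNReal.ofReal_ofNat]; ring

end

/-! ### The doubling recursion and maximal inequality for martingales. -/

/-- With U = 2^j R^(1/s), one doubling step adds h = C 2^(-js) v to R. The left side is 2^(j+1) (R +
h) R^(1/s - 1), and since s ≤ 1 the last power increases when R is replaced by R + h. -/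
theorem two_mul_add_rpow_le {s : ℝ} (hs0 : 0 < s) (hs1 : s ≤ 1) (j : ℕ) (R C v : ℝ≥0∞) :
    2 * (2 ^ j * R ^ (1 / s)) + 2 * C * ((2 ^ j * R ^ (1 / s)) ^ (1 - s) * v)
      ≤ 2 ^ (j + 1) * (R + C * (((2 : ℝ≥0∞) ^ j) ^ (-s) * v)) ^ (1 / s) := by
  set h := C * (((2 : ℝ≥0∞) ^ j) ^ (-s) * v) with hh
  have hq : 0 ≤ 1 / s - 1 := by
    rw [sub_nonneg, le_div_iff₀ hs0]; linarith
  have h2 : ((2 : ℝ≥0∞) ^ j) ≠ 0 := by simp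
  have h2' : ((2 : ℝ≥0∞) ^ j) ≠ ⊤ := by simp
  have split : ∀ X : ℝ≥0∞, X ^ (1 / s) = X * X ^ (1 / s - 1) := fun X => by
    conv_rhs => enter [1]; rw [← ENNReal.rpow_one X]
    rw [← ENNReal.rpow_add_of_nonneg _ _ zero_le_one hq]; congr 1; ring
  have e : (2 ^ j * R ^ (1 / s)) ^ (1 - s)
      = (2 : ℝ≥0∞) ^ j * ((2 : ℝ≥0∞) ^ j) ^ (-s) * R ^ (1 / s - 1) := by
    rw [ENNReal.mul_rpow_of_nonneg _ _ (by linarith), ← ENNReal.rpow_mul,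
      sub_eq_add_neg 1 s, ENNReal.rpow_add _ _ h2 h2', ENNReal.rpow_one]
    congr 2
    field_simp; ring
  rw [e]
  calc _ = 2 ^ (j + 1) * (R ^ (1 / s) + h * R ^ (1 / s - 1)) := by rw [hh]; ring
    _ = 2 ^ (j + 1) * ((R + h) * R ^ (1 / s - 1)) := by rw [split R]; ring
    _ ≤ 2 ^ (j + 1) * ((R + h) * (R + h) ^ (1 / s - 1)) := by gcongr; exact le_self_add
    _ = _ := by rw [← split]

section

variable {Ω : Type*} {mΩ : MeasurableSpace Ω} {μ : Measure Ω}

theorem integrable_of_memLp_of_two_lt [IsFiniteMeasure μ] {p : ℝ} (hp : 2 < p) {x : Ω → ℝ}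
    (hx : MemLp x (ENNReal.ofReal p) μ) : Integrable x μ :=
  hx.integrable (by
    rw [show (1 : ℝ≥0∞) = ENNReal.ofReal 1 by simp]; exact ENNReal.ofReal_le_ofReal (by linarith))

theorem memLp_two_of_two_lt [IsFiniteMeasure μ] {p : ℝ} (hp : 2 < p) {x : Ω → ℝ}
    (hx : MemLp x (ENNReal.ofReal p) μ) : MemLp x 2 μ := by
  refine hx.mono_exponent ?_
  rw [show (2 : ℝ≥0∞) = ENNReal.ofReal 2 by simp]
  exact ENNReal.ofReal_le_ofReal hp.le

/-- `d` is a sequence of `L^p` martingale differences with respect to `ℱ`, with `d k` measurable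
with respect to `ℱ (k + 1)`. -/
structure IsMartingaleDifference (ℱ : Filtration ℕ mΩ) (d : ℕ → Ω → ℝ) (p : ℝ) (μ : Measure Ω) :
    Prop where
  stronglyMeasurable : ∀ k, StronglyMeasurable[ℱ (k + 1)] (d k)
  memLp : ∀ k, MemLp (d k) (ENNReal.ofReal p) μ
  condExp_eq_zero : ∀ k, μ[d k | ℱ k] =ᵐ[μ] 0

/-- The sum of `d` over the block `[m, m + n)`. -/
def blockSum (d : ℕ → Ω → ℝ) (m n : ℕ) (ω : Ω) : ℝ := ∑ k ∈ Finset.Ico m (m + n), d k ω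

theorem blockSum_succ (d : ℕ → Ω → ℝ) (m n : ℕ) :
    blockSum d m (n + 1) = fun ω => blockSum d m n ω + d (m + n) ω := by
  ext ω
  rw [blockSum, ← add_assoc, Finset.sum_Ico_succ_top (by omega)]; rfl

theorem blockSum_add (d : ℕ → Ω → ℝ) (m n l : ℕ) (ω : Ω) :
    blockSum d m (n + l) ω = blockSum d m n ω + blockSum d (m + n) l ω := by
  rw [blockSum, blockSum, blockSum, ← add_assoc, Finset.sum_Ico_consecutive] <;> omega

namespace IsMartingaleDifference

variable {ℱ : Filtration ℕ mΩ} {d : ℕ → Ω → ℝ} {p : ℝ}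

theorem stronglyMeasurable_blockSum (hd : IsMartingaleDifference ℱ d p μ) (m n : ℕ) :
    StronglyMeasurable[ℱ (m + n)] (blockSum d m n) := by
  refine Finset.stronglyMeasurable_fun_sum _ fun k hk => ?_
  exact (hd.stronglyMeasurable k).mono (ℱ.mono (by have := Finset.mem_Ico.1 hk; omega))

theorem memLp_blockSum (hd : IsMartingaleDifference ℱ d p μ) (m n : ℕ) :
    MemLp (blockSum d m n) (ENNReal.ofReal p) μ :=
  memLp_finsetSum _ fun k _ => hd.memLp k

theorem condExp_eq_zero_of_le [IsFiniteMeasure μ] (hd : IsMartingaleDifference ℱ d p μ) {m k : ℕ}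
    (hmk : m ≤ k) : μ[d k | ℱ m] =ᵐ[μ] 0 := by
  have h1 : μ[μ[d k | ℱ k] | ℱ m] =ᵐ[μ] μ[d k | ℱ m] :=
    condExp_condExp_of_le (ℱ.mono hmk) (ℱ.le k)
  have h2 : μ[μ[d k | ℱ k] | ℱ m] =ᵐ[μ] μ[(0 : Ω → ℝ) | ℱ m] :=
    condExp_congr_ae (hd.condExp_eq_zero k)
  rw [condExp_zero] at h2
  exact h1.symm.trans h2

theorem condExp_blockSum [IsFiniteMeasure μ] (hd : IsMartingaleDifference ℱ d p μ) (hp : 2 < p)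
    (m n : ℕ) : μ[blockSum d m n | ℱ m] =ᵐ[μ] 0 := by
  induction n with
  | zero =>
    have : blockSum d m 0 = 0 := by ext; simp [blockSum]
    rw [this, condExp_zero]
  | succ n ih =>
    rw [blockSum_succ]
    have h := condExp_add (m := ℱ m) (integrable_of_memLp_of_two_lt hp (hd.memLp_blockSum m n))
      (integrable_of_memLp_of_two_lt hp (hd.memLp (m + n)))
    filter_upwards [h, ih, hd.condExp_eq_zero_of_le (show m ≤ m + n by omega)] with ω h1 h2 h3
    have : (μ[fun ω => blockSum d m n ω + d (m + n) ω | ℱ m]) ω = _ := h1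
    simp [this, h2, h3]

/-- Orthogonality: conditioning the cross term first on the σ-algebra just before the new increment
makes it vanish. -/
theorem condExp_blockSum_sq [IsFiniteMeasure μ] (hd : IsMartingaleDifference ℱ d p μ) (hp : 2 < p)
    (m n : ℕ) : μ[fun ω => blockSum d m n ω ^ 2 | ℱ m]
      =ᵐ[μ] fun ω => ∑ k ∈ Finset.Ico m (m + n), (μ[fun ω => d k ω ^ 2 | ℱ m]) ω := by
  induction n with
  | zero =>
    have : (fun ω => blockSum d m 0 ω ^ 2) = 0 := by ext; simp [blockSum]
    rw [this, condExp_zero]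
    exact Filter.Eventually.of_forall fun ω => by simp
  | succ n ih =>
    have hS := memLp_two_of_two_lt hp (hd.memLp_blockSum m n)
    have hD := memLp_two_of_two_lt hp (hd.memLp (m + n))
    have hSD : Integrable (fun ω => blockSum d m n ω * d (m + n) ω) μ := hS.integrable_mul hD
    have hz : μ[fun ω => blockSum d m n ω * d (m + n) ω | ℱ m] =ᵐ[μ] 0 := by
      have h1 := condExp_mul_of_stronglyMeasurable_left (hd.stronglyMeasurable_blockSum m n) hSD
        (hD.integrable one_le_two)
      have h2 : μ[fun ω => blockSum d m n ω * d (m + n) ω | ℱ (m + n)] =ᵐ[μ] 0 := by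
        filter_upwards [h1, hd.condExp_eq_zero (m + n)] with ω h3 h4
        have : (μ[fun ω => blockSum d m n ω * d (m + n) ω | ℱ (m + n)]) ω = _ := h3
        simp [this, h4]
      have h3 := condExp_condExp_of_le (μ := μ) (f := fun ω => blockSum d m n ω * d (m + n) ω)
        (ℱ.mono (show m ≤ m + n by omega)) (ℱ.le (m + n))
      have h4 := condExp_congr_ae (m := ℱ m) h2
      rw [condExp_zero] at h4
      exact h3.symm.trans h4
    have e : (fun ω => blockSum d m (n + 1) ω ^ 2) = (fun ω => blockSum d m n ω ^ 2)
        + ((2 : ℝ) • (fun ω => blockSum d m n ω * d (m + n) ω) + fun ω => d (m + n) ω ^ 2) := by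
      ext ω
      rw [blockSum_succ]
      simp only [Pi.add_apply, Pi.smul_apply, smul_eq_mul]
      ring
    rw [e]
    have a1 := condExp_add (m := ℱ m) hS.integrable_sq
      ((hSD.smul (2 : ℝ)).add hD.integrable_sq)
    have a2 := condExp_add (m := ℱ m) (hSD.smul (2 : ℝ)) hD.integrable_sq
    have a3 := condExp_smul (μ := μ) (2 : ℝ) (fun ω => blockSum d m n ω * d (m + n) ω) (ℱ m)
    filter_upwards [a1, a2, a3, ih, hz] with ω h1 h2 h3 h4 h5
    rw [h1, Pi.add_apply, h2, Pi.add_apply, h3, Pi.smul_apply, h4, h5, ← add_assoc m,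
      Finset.sum_Ico_succ_top (by omega)]
    simp

/-- A dyadic Rosenthal-type inequality for martingales, in terms of uniform bounds on the
conditional variances of the dyadic blocks. -/
theorem lintegral_blockSum_two_pow_le [IsFiniteMeasure μ] (hd : IsMartingaleDifference ℱ d p μ)
    (hp : 2 < p) {δ : ℝ} (hδ : δ ∈ Set.Ioc (0 : ℝ) 1) (hpδ : δ * (p - 2) ≤ 1) {A : ℝ≥0∞}
    (hA : ∀ k, ∫⁻ ω, ‖d k ω‖ₑ ^ p ∂μ ≤ A) {b : ℕ → ℝ≥0∞}
    (hb : ∀ m j, eLpNorm (μ[fun ω => blockSum d m (2 ^ j) ω ^ 2 | ℱ m])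
      (ENNReal.ofReal (p / 2)) μ ≤ b j) (K m : ℕ) :
    ∫⁻ ω, ‖blockSum d m (2 ^ K) ω‖ₑ ^ p ∂μ ≤ 2 ^ K * (A ^ (2 * δ / p)
      + ENNReal.ofReal (rosenthalConst p) * ∑ j ∈ Finset.range K,
        ((2 : ℝ≥0∞) ^ j) ^ (-(2 * δ / p)) * b j ^ δ) ^ (1 / (2 * δ / p)) := by
  have hδ0 := hδ.1
  have hs0 : 0 < 2 * δ / p := by positivity
  have hs1 : 2 * δ / p ≤ 1 := by
    rw [div_le_one (by linarith)]; linarith [hδ.2]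
  -- The starting point must vary, since the second half of a block starts at m + 2^K.
  induction K generalizing m with
  | zero =>
    rw [Finset.sum_range_zero, mul_zero, add_zero, ← ENNReal.rpow_mul, mul_one_div_cancel hs0.ne']
    simpa [blockSum] using hA m
  | succ K ih =>
    have h := lintegral_add_rpow_le (ℱ.le (m + 2 ^ K)) hp hδ hpδ
      (hd.stronglyMeasurable_blockSum m (2 ^ K)) (hd.memLp_blockSum m (2 ^ K))
      (hd.memLp_blockSum (m + 2 ^ K) (2 ^ K)) (hd.condExp_blockSum hp _ _) (ih m) (ih _) (hb _ K)
    simp only [← blockSum_add] at h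
    rw [pow_succ 2 K, mul_two]
    refine h.trans ?_
    rw [Finset.sum_range_succ, mul_add, ← add_assoc,
      ENNReal.ofReal_mul (by norm_num), ENNReal.ofReal_ofNat]
    exact two_mul_add_rpow_le hs0 hs1 K _ _ _

/-- **Doob's maximal inequality** at exponent `p` for the partial sums. -/
theorem measure_exists_le_abs_blockSum_le [IsFiniteMeasure μ]
    (hd : IsMartingaleDifference ℱ d p μ) (hp : 2 < p) (n : ℕ) {x : ℝ} (hx : 0 < x) :
    μ {ω | ∃ i ≤ n, x ≤ |blockSum d 0 i ω|}
      ≤ (∫⁻ ω, ‖blockSum d 0 n ω‖ₑ ^ p ∂μ) / ENNReal.ofReal x ^ p := by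
  have hp0 : 0 < p := by linarith
  have hint : ∀ i, Integrable (fun ω => |blockSum d 0 i ω| ^ p) μ := fun i =>
    (hd.memLp_blockSum 0 i).integrable_abs_rpow hp0
  have hmart : ∀ i j, i ≤ j → μ[blockSum d 0 j | ℱ i] =ᵐ[μ] blockSum d 0 i := by
    intro i j hij
    obtain ⟨l, rfl⟩ := Nat.exists_eq_add_of_le hij
    have e : blockSum d 0 (i + l) = blockSum d 0 i + blockSum d i l := by
      ext ω; simp [blockSum_add]
    rw [e]
    have h1 := condExp_add (m := ℱ i) (integrable_of_memLp_of_two_lt hp (hd.memLp_blockSum 0 i))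
      (integrable_of_memLp_of_two_lt hp (hd.memLp_blockSum i l))
    have hm : StronglyMeasurable[ℱ i] (blockSum d 0 i) :=
      (hd.stronglyMeasurable_blockSum 0 i).mono (ℱ.mono (by omega))
    filter_upwards [h1, hd.condExp_blockSum hp i l] with ω h2 h3
    rw [h2, Pi.add_apply, h3,
      condExp_of_stronglyMeasurable (ℱ.le i) hm (integrable_of_memLp_of_two_lt hp (hd.memLp_blockSum 0 i))]
    simp
  -- Conditional Jensen for |·|^p; Doob's inequality is applied to this submartingale at level x^p.
  have hsub : Submartingale (fun i ω => |blockSum d 0 i ω| ^ p) ℱ μ := by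
    refine ⟨fun i => ?_, fun i j hij => ?_, hint⟩
    · have hm : StronglyMeasurable[ℱ i] (blockSum d 0 i) :=
        (hd.stronglyMeasurable_blockSum 0 i).mono (ℱ.mono (by omega))
      exact ((measurable_id.abs.pow_const p).comp hm.measurable).stronglyMeasurable
    · have h := Integrable.norm_condExp_rpow_le (m := ℱ i) (f := blockSum d 0 j) (p := p)
        (by linarith) (hint j)
      filter_upwards [h, hmart i j hij] with ω h1 h2
      rw [h2] at h1
      exact h1
  have hxp : 0 < x ^ p := Real.rpow_pos_of_pos hx _
  obtain ⟨ε, hε⟩ : ∃ ε : ℝ≥0, (ε : ℝ) = x ^ p := ⟨⟨x ^ p, hxp.le⟩, rfl⟩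
  have hdoob := maximal_ineq hsub (fun i ω => by positivity) (ε := ε) n
  set E := {ω | (ε : ℝ) ≤ (Finset.range (n + 1)).sup'
    Finset.nonempty_range_add_one fun k => |blockSum d 0 k ω| ^ p} with hE
  have hsubE : {ω | ∃ i ≤ n, x ≤ |blockSum d 0 i ω|} ⊆ E := by
    rintro ω ⟨i, hi, hxi⟩
    have h : (ε : ℝ) ≤ |blockSum d 0 i ω| ^ p := by
      rw [hε]
      exact Real.rpow_le_rpow hx.le hxi hp0.le
    exact h.trans (Finset.le_sup' (fun k => |blockSum d 0 k ω| ^ p)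
      (Finset.mem_range.2 (Nat.lt_succ_of_le hi)))
  have eL : ∫⁻ ω, ‖blockSum d 0 n ω‖ₑ ^ p ∂μ
      = ENNReal.ofReal (∫ ω, |blockSum d 0 n ω| ^ p ∂μ) := by
    rw [ofReal_integral_eq_lintegral_ofReal (hint n)
      (Filter.Eventually.of_forall fun ω => by positivity)]
    refine lintegral_congr fun ω => ?_
    rw [← ENNReal.ofReal_rpow_of_nonneg (abs_nonneg _) hp0.le, ← Real.norm_eq_abs, ofReal_norm]
  have ex : ENNReal.ofReal x ^ p = (ε : ℝ≥0∞) := by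
    rw [ENNReal.ofReal_rpow_of_nonneg hx.le hp0.le, ← hε, ENNReal.ofReal_coe_nnreal]
  have hε0 : ε ≠ 0 := by
    rintro rfl
    simp at hε
    exact hxp.ne hε
  rw [ENNReal.le_div_iff_mul_le (Or.inl (by rw [ex]; simpa using hε0))
    (Or.inl (by rw [ex]; exact ENNReal.coe_ne_top)), mul_comm, eL, ex]
  calc _ ≤ _ := mul_le_mul_right (measure_mono hsubE) _
    _ ≤ _ := hdoob
    _ ≤ _ := ENNReal.ofReal_le_ofReal (setIntegral_le_integral (hint n)
      (Filter.Eventually.of_forall fun ω => by positivity))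

end IsMartingaleDifference

end

/-! ### Conditional expectations along shifts and the natural filtration. -/

section

variable {Ω : Type*} {mΩ : MeasurableSpace Ω} {μ : Measure Ω}

/-- Conditional expectations commute with pulling back along a measurable map. -/
theorem condExp_comp_comap {E : Type*} {m mE : MeasurableSpace E} [IsFiniteMeasure μ]
    (hm : m ≤ mE) {X : Ω → E} (hX : Measurable X) {h : E → ℝ} (hh : Integrable h (μ.map X)) :
    μ[h ∘ X | m.comap X] =ᵐ[μ] (μ.map X)[h | m] ∘ X := by
  have hle : m.comap X ≤ mΩ := (MeasurableSpace.comap_mono hm).trans hX.comap_le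
  have hc : Integrable ((μ.map X)[h | m]) (μ.map X) := integrable_condExp
  refine (ae_eq_condExp_of_forall_setIntegral_eq hle (hh.comp_measurable hX)
    (fun s _ _ => (hc.comp_measurable hX).integrableOn) ?_ ?_).symm
  · rintro _ ⟨t, ht, rfl⟩ -
    have h1 := setIntegral_map (μ := μ) (hm t ht) hc.1 hX.aemeasurable
    have h2 := setIntegral_map (μ := μ) (hm t ht) hh.1 hX.aemeasurable
    simp only [Function.comp_apply]
    rw [← h1, ← h2, setIntegral_condExp hm hh ht]
  · have hsm : StronglyMeasurable[m] ((μ.map X)[h | m]) := stronglyMeasurable_condExp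
    exact (hsm.comp_measurable (comap_measurable X)).aestronglyMeasurable

/-- Tower property and L^q contraction. It serves twice: to pass from the natural filtration to the
given one, and to show that dependence decreases with the lag. -/
theorem eLpNorm_condExp_sub_const_le [IsFiniteMeasure μ] {m₁ m₂ : MeasurableSpace Ω}
    (h₁₂ : m₁ ≤ m₂) (h₂ : m₂ ≤ mΩ) (f : Ω → ℝ) (c : ℝ) {q : ℝ≥0∞} (hq : 1 ≤ q) :
    eLpNorm (fun ω => (μ[f | m₁]) ω - c) q μ ≤ eLpNorm (fun ω => (μ[f | m₂]) ω - c) q μ := by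
  have e : (fun ω => (μ[f | m₁]) ω - c) =ᵐ[μ] μ[fun ω => (μ[f | m₂]) ω - c | m₁] := by
    have a1 := condExp_sub (m := m₁) (integrable_condExp (m := m₂) (μ := μ) (f := f))
      (integrable_const c)
    have a2 := condExp_condExp_of_le (μ := μ) (f := f) h₁₂ h₂
    filter_upwards [a1, a2] with ω h3 h4
    have : (μ[fun ω => (μ[f | m₂]) ω - c | m₁]) ω = _ := h3
    rw [this, Pi.sub_apply, h4, condExp_const (h₁₂.trans h₂)]
  rw [eLpNorm_congr_ae e]
  exact eLpNorm_condExp_le_eLpNorm _ hq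

/-- The shift of a process. -/
def shiftProcess (Z : ℤ → Ω → ℝ) (k : ℤ) (ω : Ω) (i : ℤ) : ℝ := Z (i + k) ω

/-- The σ-algebra of the coordinates of nonpositive index. -/
abbrev coordinatePast : MeasurableSpace (ℤ → ℝ) :=
  ⨆ j ∈ Set.Iic (0 : ℤ), MeasurableSpace.comap (fun z : ℤ → ℝ => z j) inferInstance

theorem coordinatePast_le : coordinatePast ≤ MeasurableSpace.pi :=
  iSup₂_le fun j _ => (measurable_pi_apply j).comap_le

theorem measurable_shiftProcess {Z : ℤ → Ω → ℝ} (hZ : ∀ i, Measurable (Z i)) (k : ℤ) :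
    Measurable (shiftProcess Z k) :=
  measurable_pi_lambda _ fun i => hZ (i + k)

/-- Identifies the pulled-back σ-algebra with the one generated by `Z i`, i ≤ k. Writing it as the
pullback of one fixed σ-algebra is what makes stationarity applicable to conditional expectations.
-/
theorem comap_shiftProcess_le_iff {Z : ℤ → Ω → ℝ} {k : ℤ} {m : MeasurableSpace Ω} :
    coordinatePast.comap (shiftProcess Z k) ≤ m ↔ ∀ i ≤ k, Measurable[m] (Z i) := by
  simp only [coordinatePast, MeasurableSpace.comap_iSup, MeasurableSpace.comap_comp, iSup_le_iff,
    Set.mem_Iic, ← measurable_iff_comap_le]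
  refine ⟨fun h i hi => ?_, fun h j hj => h (j + k) (by omega)⟩
  have := h (i - k) (by omega)
  have e : (fun z : ℤ → ℝ => z (i - k)) ∘ shiftProcess Z k = Z i := by
    ext ω; simp [shiftProcess]
  rwa [e] at this

/-- The natural filtration of a process indexed by `ℤ`, written as the pullback of a fixed
σ-algebra along the shifts. -/
def shiftFiltration (Z : ℤ → Ω → ℝ) (hZ : ∀ i, Measurable (Z i)) : Filtration ℤ mΩ where
  seq k := coordinatePast.comap (shiftProcess Z k)
  mono' _ _ hkl := comap_shiftProcess_le_iff.2 fun i hi =>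
    comap_shiftProcess_le_iff.1 le_rfl i (hi.trans hkl)
  le' _ := comap_shiftProcess_le_iff.2 fun i _ => hZ i

theorem measurable_shiftFiltration {Z : ℤ → Ω → ℝ} (hZ : ∀ i, Measurable (Z i)) {i k : ℤ}
    (hik : i ≤ k) : Measurable[shiftFiltration Z hZ k] (Z i) :=
  comap_shiftProcess_le_iff.1 le_rfl i hik

theorem shiftFiltration_le {Z : ℤ → Ω → ℝ} (hZ : ∀ i, Measurable (Z i)) {G : Filtration ℤ mΩ}
    (hG : Adapted G Z) (k : ℤ) : shiftFiltration Z hZ k ≤ G k :=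
  comap_shiftProcess_le_iff.2 fun i hi => (hG i).mono (G.mono hi) le_rfl

theorem IsStrictlyStationary.map_shiftProcess {Z : ℤ → Ω → ℝ} (hs : IsStrictlyStationary Z μ)
    (k : ℤ) : μ.map (shiftProcess Z k) = μ.map (shiftProcess Z 0) :=
  (hs k).map_eq.trans (hs 0).map_eq.symm

theorem IsStrictlyStationary.identDistrib {Z : ℤ → Ω → ℝ} (hs : IsStrictlyStationary Z μ)
    (i j : ℤ) : IdentDistrib (Z i) (Z j) μ μ := by
  have h : ∀ k, IdentDistrib (Z k) (Z 0) μ μ := fun k => by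
    simpa [Function.comp_def] using (hs k).comp (measurable_pi_apply (0 : ℤ))
  exact (h i).trans (h j).symm

/-- Both norms are computed on path space, where the conditional expectation depends only on the law
of the shifted process, and that law is the same for every shift. -/
theorem IsStrictlyStationary.eLpNorm_condExp_shift [IsFiniteMeasure μ] {Z : ℤ → Ω → ℝ}
    (hs : IsStrictlyStationary Z μ) (hZ : ∀ i, Measurable (Z i)) {g : ℝ → ℝ} (hg : Measurable g)
    (i k : ℤ) (hint : Integrable (fun ω => g (Z i ω)) μ) (c : ℝ) (q : ℝ≥0∞) :
    eLpNorm (fun ω => (μ[fun ω => g (Z (i + k) ω) | shiftFiltration Z hZ k]) ω - c) q μ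
      = eLpNorm (fun ω => (μ[fun ω => g (Z i ω) | shiftFiltration Z hZ 0]) ω - c) q μ := by
  have key : ∀ k, eLpNorm (fun ω => (μ[fun ω => g (Z (i + k) ω) | shiftFiltration Z hZ k]) ω - c)
      q μ = eLpNorm (fun z => ((μ.map (shiftProcess Z 0))[fun z => g (z i) | coordinatePast]) z - c)
        q (μ.map (shiftProcess Z 0)) := fun k => by
    have hX := measurable_shiftProcess hZ k
    have hgi : Measurable fun z : ℤ → ℝ => g (z i) := hg.comp (measurable_pi_apply i)
    have hik : Integrable (fun z : ℤ → ℝ => g (z i)) (μ.map (shiftProcess Z k)) := by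
      rw [integrable_map_measure hgi.aestronglyMeasurable hX.aemeasurable]
      exact ((hs.identDistrib i (i + k)).comp hg).integrable_iff.1 hint
    have h := condExp_comp_comap coordinatePast_le hX hik
    have hmeas : AEStronglyMeasurable (fun z =>
        ((μ.map (shiftProcess Z k))[fun z => g (z i) | coordinatePast]) z - c)
        (μ.map (shiftProcess Z k)) :=
      integrable_condExp.1.sub aestronglyMeasurable_const
    rw [← hs.map_shiftProcess k, eLpNorm_map_measure hmeas hX.aemeasurable]
    refine eLpNorm_congr_ae ?_
    filter_upwards [h] with ω hω
    have : (μ[fun ω => g (Z (i + k) ω) | shiftFiltration Z hZ k]) ω = _ := hω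
    rw [this]
    rfl
  rw [key k, ← key 0, add_zero]

end

/-! ### Martingale differences two steps apart and their conditional variances. -/

section

variable {Ω : Type*} {mΩ : MeasurableSpace Ω} {μ : Measure Ω}

theorem lintegral_enorm_rpow_eq_eLpNorm_rpow {p : ℝ} (hp : 0 < p) (f : Ω → ℝ) :
    ∫⁻ ω, ‖f ω‖ₑ ^ p ∂μ = eLpNorm f (ENNReal.ofReal p) μ ^ p := by
  rw [eLpNorm_eq_lintegral_rpow_enorm_toReal (by simpa using hp) ENNReal.ofReal_ne_top,
    ENNReal.toReal_ofReal hp.le, ← ENNReal.rpow_mul, one_div_mul_cancel hp.ne', ENNReal.rpow_one]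

/-- The process `Z i` with its projection on the past of index `i - 2` removed. -/
noncomputable def projDiff (μ : Measure Ω) (Z : ℤ → Ω → ℝ) (hZ : ∀ i, Measurable (Z i)) (i : ℤ)
    (ω : Ω) : ℝ :=
  Z i ω - (μ[Z i | shiftFiltration Z hZ (i - 2)]) ω

/-- Every second σ-algebra of the natural filtration. -/
def skipFiltration (Z : ℤ → Ω → ℝ) (hZ : ∀ i, Measurable (Z i)) (c : ℤ) : Filtration ℕ mΩ where
  -- The l-th difference has index 2l + 1 + c: two more than this level, and exactly the next level.
  -- It is thus centred given level l and measurable at level l + 1.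
  seq l := shiftFiltration Z hZ (2 * l + c - 1)
  mono' _ _ h := (shiftFiltration Z hZ).mono (by have : ((_ : ℕ) : ℤ) ≤ _ := Int.ofNat_le.2 h; omega)
  le' _ := (shiftFiltration Z hZ).le _

variable {Z : ℤ → Ω → ℝ} {p : ℝ}

theorem IsStrictlyStationary.memLp (hs : IsStrictlyStationary Z μ) {q : ℝ≥0∞}
    (h1 : MemLp (Z 1) q μ) (i : ℤ) : MemLp (Z i) q μ :=
  (hs.identDistrib i 1).memLp_iff.2 h1

theorem IsStrictlyStationary.isMartingaleDifference_projDiff [IsFiniteMeasure μ]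
    (hs : IsStrictlyStationary Z μ) (hZ : ∀ i, Measurable (Z i)) (hp : 2 < p)
    (h1 : MemLp (Z 1) (ENNReal.ofReal p) μ) (c : ℤ) :
    IsMartingaleDifference (skipFiltration Z hZ c) (fun l => projDiff μ Z hZ (2 * l + 1 + c)) p μ := by
  have hp1 : 1 ≤ ENNReal.ofReal p := by
    rw [show (1 : ℝ≥0∞) = ENNReal.ofReal 1 by simp]; exact ENNReal.ofReal_le_ofReal (by linarith)
  refine ⟨fun k => ?_, fun k => ?_, fun k => ?_⟩
  · refine StronglyMeasurable.sub ?_ (stronglyMeasurable_condExp.mono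
      ((shiftFiltration Z hZ).mono (by push_cast; omega)))
    exact (measurable_shiftFiltration hZ (by push_cast; omega)).stronglyMeasurable
  · exact (hs.memLp h1 _).sub ((hs.memLp h1 _).condExp hp1)
  · set i : ℤ := 2 * k + 1 + c with hi
    have e : skipFiltration Z hZ c k = shiftFiltration Z hZ (i - 2) := by
      show shiftFiltration Z hZ (2 * k + c - 1) = _
      congr 1; omega
    rw [e]
    have a1 := condExp_sub (m := shiftFiltration Z hZ (i - 2))
      ((hs.memLp h1 i).integrable hp1) (integrable_condExp (m := shiftFiltration Z hZ (i - 2))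
        (μ := μ) (f := Z i))
    have a2 := condExp_condExp_of_le (μ := μ) (f := Z i)
      (le_refl (shiftFiltration Z hZ (i - 2) : MeasurableSpace Ω))
      ((shiftFiltration Z hZ).le (i - 2))
    filter_upwards [a1, a2] with ω h3 h4
    have : (μ[projDiff μ Z hZ i | shiftFiltration Z hZ (i - 2)]) ω = _ := h3
    rw [this, Pi.sub_apply, h4, sub_self]; rfl

theorem IsStrictlyStationary.lintegral_projDiff_le [IsFiniteMeasure μ]
    (hs : IsStrictlyStationary Z μ) (hZ : ∀ i, Measurable (Z i)) (hp : 2 < p) (i : ℤ) :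
    ∫⁻ ω, ‖projDiff μ Z hZ i ω‖ₑ ^ p ∂μ ≤ 2 ^ p * ∫⁻ ω, ‖Z 1 ω‖ₑ ^ p ∂μ := by
  have hp0 : 0 < p := by linarith
  have hp1 : 1 ≤ ENNReal.ofReal p := by
    rw [show (1 : ℝ≥0∞) = ENNReal.ofReal 1 by simp]; exact ENNReal.ofReal_le_ofReal (by linarith)
  rw [lintegral_enorm_rpow_eq_eLpNorm_rpow hp0, lintegral_enorm_rpow_eq_eLpNorm_rpow hp0,
    ← ENNReal.mul_rpow_of_nonneg _ _ hp0.le]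
  refine ENNReal.rpow_le_rpow ?_ hp0.le
  calc eLpNorm (projDiff μ Z hZ i) (ENNReal.ofReal p) μ
      ≤ eLpNorm (Z i) (ENNReal.ofReal p) μ
        + eLpNorm (μ[Z i | shiftFiltration Z hZ (i - 2)]) (ENNReal.ofReal p) μ :=
        eLpNorm_sub_le (hZ i).aestronglyMeasurable integrable_condExp.1 hp1
    _ ≤ eLpNorm (Z i) (ENNReal.ofReal p) μ + eLpNorm (Z i) (ENNReal.ofReal p) μ := by
        gcongr; exact eLpNorm_condExp_le_eLpNorm _ hp1
    _ = 2 * eLpNorm (Z 1) (ENNReal.ofReal p) μ := by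
        rw [(hs.identDistrib i 1).eLpNorm_eq, two_mul]

/-- The `L^q` distance between the conditional second moment of `Z i` given the natural past of
index `0` and the second moment. -/
noncomputable def sqDependence (μ : Measure Ω) (Z : ℤ → Ω → ℝ) (hZ : ∀ i, Measurable (Z i))
    (q : ℝ≥0∞) (i : ℤ) : ℝ≥0∞ :=
  eLpNorm (fun ω => (μ[fun ω => Z i ω ^ 2 | shiftFiltration Z hZ 0]) ω - ∫ ω, Z 1 ω ^ 2 ∂μ) q μ

theorem IsStrictlyStationary.eLpNorm_condExp_sq_sub [IsFiniteMeasure μ]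
    (hs : IsStrictlyStationary Z μ) (hZ : ∀ i, Measurable (Z i)) (h1 : MemLp (Z 1) 2 μ)
    (q : ℝ≥0∞) (i k : ℤ) :
    eLpNorm (fun ω => (μ[fun ω => Z (i + k) ω ^ 2 | shiftFiltration Z hZ k]) ω
      - ∫ ω, Z 1 ω ^ 2 ∂μ) q μ = sqDependence μ Z hZ q i :=
  hs.eLpNorm_condExp_shift hZ (g := fun t => t ^ 2) (by fun_prop) i k
    (hs.memLp h1 i).integrable_sq _ q

/-- By stationarity the coefficient at i ≤ j is also that of `Z j` given the past of j - i, which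
contains the past of 0. -/
theorem IsStrictlyStationary.sqDependence_antitone [IsFiniteMeasure μ]
    (hs : IsStrictlyStationary Z μ) (hZ : ∀ i, Measurable (Z i)) (h1 : MemLp (Z 1) 2 μ)
    {q : ℝ≥0∞} (hq : 1 ≤ q) : Antitone (sqDependence μ Z hZ q) := by
  intro i j hij
  rw [← hs.eLpNorm_condExp_sq_sub hZ h1 q i (j - i), add_sub_cancel]
  exact eLpNorm_condExp_sub_const_le ((shiftFiltration Z hZ).mono (by omega))
    ((shiftFiltration Z hZ).le _) _ _ hq

/-- A conditional variance is at most the conditional second moment; conditioning both further on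
the earlier past preserves this. -/
theorem condExp_projDiff_sq_le [IsFiniteMeasure μ] (hZ : ∀ i, Measurable (Z i)) {i k : ℤ}
    (hi : MemLp (Z i) 2 μ) (hk : k ≤ i - 2) :
    μ[fun ω => projDiff μ Z hZ i ω ^ 2 | shiftFiltration Z hZ k]
      ≤ᵐ[μ] μ[fun ω => Z i ω ^ 2 | shiftFiltration Z hZ k] := by
  have h := condVar_ae_le_condExp_sq ((shiftFiltration Z hZ).le (i - 2)) hi
  have h2 : Var[Z i; μ | shiftFiltration Z hZ (i - 2)]
      = μ[fun ω => projDiff μ Z hZ i ω ^ 2 | shiftFiltration Z hZ (i - 2)] := rfl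
  rw [h2] at h
  have h3 := condExp_mono (m := shiftFiltration Z hZ k) integrable_condExp integrable_condExp h
  have a1 := condExp_condExp_of_le (μ := μ) (f := fun ω => projDiff μ Z hZ i ω ^ 2)
    ((shiftFiltration Z hZ).mono hk) ((shiftFiltration Z hZ).le (i - 2))
  have a2 := condExp_condExp_of_le (μ := μ) (f := Z i ^ 2)
    ((shiftFiltration Z hZ).mono hk) ((shiftFiltration Z hZ).le (i - 2))
  filter_upwards [h3, a1, a2] with ω h4 h5 h6
  rw [h5, h6] at h4
  exact h4

theorem IsStrictlyStationary.eLpNorm_condExp_projDiff_sq_le [IsProbabilityMeasure μ]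
    (hs : IsStrictlyStationary Z μ) (hZ : ∀ i, Measurable (Z i)) (h1 : MemLp (Z 1) 2 μ)
    {q : ℝ≥0∞} (hq : 1 ≤ q) {i k : ℤ} (hk : k ≤ i - 2) :
    eLpNorm (μ[fun ω => projDiff μ Z hZ i ω ^ 2 | shiftFiltration Z hZ k]) q μ
      ≤ (∫⁻ ω, ‖Z 1 ω‖ₑ ^ 2 ∂μ) + sqDependence μ Z hZ q (i - k) := by
  have hpos : 0 ≤ᵐ[μ] μ[fun ω => projDiff μ Z hZ i ω ^ 2 | shiftFiltration Z hZ k] :=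
    condExp_nonneg (Filter.Eventually.of_forall fun ω => sq_nonneg _)
  have hle : eLpNorm (μ[fun ω => projDiff μ Z hZ i ω ^ 2 | shiftFiltration Z hZ k]) q μ
      ≤ eLpNorm (μ[fun ω => Z i ω ^ 2 | shiftFiltration Z hZ k]) q μ := by
    refine eLpNorm_mono_ae ?_
    filter_upwards [hpos, condExp_projDiff_sq_le hZ (hs.memLp h1 i) hk] with ω h2 h3
    rw [Real.norm_of_nonneg h2]
    exact h3.trans (le_abs_self _)
  refine hle.trans ?_
  set v := ∫ ω, Z 1 ω ^ 2 ∂μ with hv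
  have e : (μ[fun ω => Z i ω ^ 2 | shiftFiltration Z hZ k])
      = (fun _ => v) + fun ω => (μ[fun ω => Z i ω ^ 2 | shiftFiltration Z hZ k]) ω - v := by
    ext ω; simp
  rw [e]
  refine (eLpNorm_add_le aestronglyMeasurable_const
    (integrable_condExp.1.sub aestronglyMeasurable_const) hq).trans (add_le_add ?_ ?_)
  · rw [eLpNorm_const v (zero_lt_one.trans_le hq).ne' (IsProbabilityMeasure.ne_zero μ)]
    simp only [measure_univ, ENNReal.one_rpow, mul_one]
    refine (enorm_integral_le_lintegral_enorm _).trans (le_of_eq (lintegral_congr fun ω => ?_))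
    rw [enorm_pow]
  · have := hs.eLpNorm_condExp_sq_sub hZ h1 q (i - k) k
    rw [sub_add_cancel] at this
    exact this.le

/-- Supplies the b_j of the doubling recursion. Conditional variances add up over the block, and
every lag is at least 2, so the coefficients start at i = 2. -/
theorem IsStrictlyStationary.eLpNorm_condExp_blockSum_sq_le [IsProbabilityMeasure μ]
    (hs : IsStrictlyStationary Z μ) (hZ : ∀ i, Measurable (Z i)) (hp : 2 < p)
    (h1 : MemLp (Z 1) (ENNReal.ofReal p) μ) (c : ℤ) (m n : ℕ) :
    eLpNorm (μ[fun ω => blockSum (fun l => projDiff μ Z hZ (2 * l + 1 + c)) m n ω ^ 2 |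
        skipFiltration Z hZ c m]) (ENNReal.ofReal (p / 2)) μ
      ≤ n * (∫⁻ ω, ‖Z 1 ω‖ₑ ^ 2 ∂μ)
        + ∑ i ∈ Finset.Icc 2 (n + 1), sqDependence μ Z hZ (ENNReal.ofReal (p / 2)) (i : ℕ) := by
  have hd := hs.isMartingaleDifference_projDiff hZ hp h1 c
  have h2 := memLp_two_of_two_lt hp h1
  have hq : 1 ≤ ENNReal.ofReal (p / 2) := by
    rw [show (1 : ℝ≥0∞) = ENNReal.ofReal 1 by simp]; exact ENNReal.ofReal_le_ofReal (by linarith)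
  rw [eLpNorm_congr_ae (hd.condExp_blockSum_sq hp m n)]
  have e : (fun ω => ∑ k ∈ Finset.Ico m (m + n),
      (μ[fun ω => projDiff μ Z hZ (2 * k + 1 + c) ω ^ 2 | skipFiltration Z hZ c m]) ω)
      = ∑ k ∈ Finset.Ico m (m + n),
      (μ[fun ω => projDiff μ Z hZ (2 * k + 1 + c) ω ^ 2 | skipFiltration Z hZ c m]) := by
    ext ω; simp
  rw [e]
  refine (eLpNorm_sum_le (fun k _ => integrable_condExp.1) hq).trans ?_
  have hk : ∀ k ∈ Finset.Ico m (m + n),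
      eLpNorm (μ[fun ω => projDiff μ Z hZ (2 * k + 1 + c) ω ^ 2 | skipFiltration Z hZ c m])
        (ENNReal.ofReal (p / 2)) μ
      ≤ (∫⁻ ω, ‖Z 1 ω‖ₑ ^ 2 ∂μ)
        + sqDependence μ Z hZ (ENNReal.ofReal (p / 2)) ((k - m + 2 : ℕ)) := by
    intro k hk
    have hk' := (Finset.mem_Ico.1 hk).1
    refine (hs.eLpNorm_condExp_projDiff_sq_le hZ h2 hq (i := 2 * k + 1 + c)
      (k := 2 * m + c - 1) (by omega)).trans ?_
    gcongr
    -- The true lag is 2(k - m) + 2; lowering it to k - m + 2 only increases the coefficient and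
    -- makes the lags consecutive.
    exact hs.sqDependence_antitone hZ h2 hq (by push_cast [Nat.cast_sub hk']; omega)
  refine (Finset.sum_le_sum hk).trans (le_of_eq ?_)
  rw [Finset.sum_add_distrib, Finset.sum_const, Nat.card_Ico, add_tsub_cancel_left, nsmul_eq_mul]
  congr 1
  rw [Finset.sum_Ico_eq_sum_range, add_tsub_cancel_left, ← Finset.Ico_succ_right_eq_Icc,
    Finset.sum_Ico_eq_sum_range]
  refine Finset.sum_congr (by simp) fun i _ => ?_
  congr 2; omega

end

/-! ### From dyadic sums to sums over all integers. -/

theorem exists_sum_two_pow_rpow_le {γ : ℝ} (hγ : 0 < γ) :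
    ∃ c : ℝ≥0, ∀ K : ℕ, ∑ j ∈ Finset.range K, ((2 : ℝ≥0∞) ^ j) ^ γ ≤ c * ((2 : ℝ≥0∞) ^ K) ^ γ := by
  have hρ : 1 < (2 : ℝ≥0) ^ γ := NNReal.one_lt_rpow (by norm_num) hγ
  obtain ⟨τ, hτ⟩ := exists_add_of_le hρ.le
  have hτ0 : τ ≠ 0 := by rintro rfl; simp [hτ] at hρ
  -- With τ = 2^γ - 1, the constant 1/τ is chosen so that the induction step closes with equality.
  have hc : τ⁻¹ + 1 = τ⁻¹ * (2 : ℝ≥0) ^ γ := by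
    rw [hτ]; field_simp
  have hcE : ((τ⁻¹ : ℝ≥0) : ℝ≥0∞) + 1 = (τ⁻¹ : ℝ≥0) * (2 : ℝ≥0∞) ^ γ := by
    have : ((2 : ℝ≥0∞)) ^ γ = (((2 : ℝ≥0) ^ γ : ℝ≥0) : ℝ≥0∞) := by
      rw [ENNReal.coe_rpow_of_nonneg _ hγ.le]; rfl
    rw [this]
    exact_mod_cast hc
  refine ⟨τ⁻¹, fun K => ?_⟩
  induction K with
  | zero => simp
  | succ K ih =>
    rw [Finset.sum_range_succ, pow_succ 2 K, ENNReal.mul_rpow_of_nonneg _ _ hγ.le]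
    calc _ ≤ (τ⁻¹ : ℝ≥0) * ((2 : ℝ≥0∞) ^ K) ^ γ + ((2 : ℝ≥0∞) ^ K) ^ γ := by gcongr
      _ = (((τ⁻¹ : ℝ≥0) : ℝ≥0∞) + 1) * ((2 : ℝ≥0∞) ^ K) ^ γ := by ring
      _ = _ := by rw [hcE]; ring

/-- Comparison of a sum over dyadic integers with a sum over all integers. -/
theorem sum_two_pow_rpow_mul_le {s : ℝ} (hs : 0 < s) {g : ℕ → ℝ≥0∞} (hg : Monotone g) (K : ℕ) :
    ∑ j ∈ Finset.range K, ((2 : ℝ≥0∞) ^ j) ^ (-s) * g (2 ^ j + 1)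
      ≤ 2 ^ (1 + s) * ∑ k ∈ Finset.Icc (1 : ℕ) (2 ^ K), 1 / (k : ℝ≥0∞) ^ (1 + s) * g k := by
  induction K with
  | zero => simp
  | succ K ih =>
    have h2 : ((2 : ℝ≥0∞) ^ K) ≠ 0 := by simp
    have h2' : ((2 : ℝ≥0∞) ^ K) ≠ ⊤ := by simp
    have hsub : Finset.Icc 1 (2 ^ (K + 1)) =
        Finset.Icc 1 (2 ^ K) ∪ Finset.Ioc (2 ^ K) (2 ^ (K + 1)) := by
      have := Nat.one_le_two_pow (n := K)
      have := pow_succ 2 K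
      ext k; simp only [Finset.mem_Icc, Finset.mem_union, Finset.mem_Ioc]; omega
    have hdisj : Disjoint (Finset.Icc 1 (2 ^ K)) (Finset.Ioc (2 ^ K) (2 ^ (K + 1))) :=
      Finset.disjoint_left.2 fun k h1 h2 => by
        have := (Finset.mem_Icc.1 h1).2
        have := (Finset.mem_Ioc.1 h2).1
        omega
    rw [Finset.sum_range_succ, hsub, Finset.sum_union hdisj, mul_add]
    refine add_le_add ih ?_
    have hcard : (Finset.Ioc (2 ^ K) (2 ^ (K + 1))).card = 2 ^ K := by
      rw [Nat.card_Ioc, pow_succ]; omega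
    -- The dyadic term at K is spread over the 2^K integers k with 2^K < k ≤ 2^(K+1): there g k ≥
    -- g(2^K + 1) and k^(1+s) ≤ (2·2^K)^(1+s).
    have hterm : ∀ k ∈ Finset.Ioc ((2 : ℕ) ^ K) (2 ^ (K + 1)),
        1 / ((2 : ℝ≥0∞) * 2 ^ K) ^ (1 + s) * g (2 ^ K + 1) ≤ 1 / (k : ℝ≥0∞) ^ (1 + s) * g k := by
      intro k hk
      obtain ⟨hk1, hk2⟩ := Finset.mem_Ioc.1 hk
      have : (k : ℝ≥0∞) ≤ 2 * 2 ^ K := by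
        rw [← pow_succ']; exact_mod_cast hk2
      gcongr
      exact hg hk1
    have h := Finset.sum_le_sum hterm
    rw [Finset.sum_const, hcard, nsmul_eq_mul] at h
    refine le_trans (le_of_eq ?_) (mul_le_mul_right h _)
    have ht : (2 : ℝ≥0∞) ^ (1 + s) ≠ 0 := by simp
    have ht' : (2 : ℝ≥0∞) ^ (1 + s) ≠ ⊤ := ENNReal.rpow_ne_top_of_nonneg (by linarith) (by simp)
    rw [ENNReal.mul_rpow_of_nonneg _ _ (by linarith : 0 ≤ 1 + s), one_div,
      ENNReal.mul_inv (Or.inl ht) (Or.inl ht'), ← ENNReal.rpow_neg ((2 : ℝ≥0∞) ^ K)]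
    have e : ((2 : ℝ≥0∞) ^ K) ^ (-s) = 2 ^ K * ((2 : ℝ≥0∞) ^ K) ^ (-(1 + s)) := by
      conv_rhs => enter [1]; rw [← ENNReal.rpow_one ((2 : ℝ≥0∞) ^ K)]
      rw [← ENNReal.rpow_add _ _ h2 h2']; congr 1; ring
    rw [e]
    push_cast
    calc _ = ((2 : ℝ≥0∞) ^ (1 + s) * (2 ^ (1 + s))⁻¹)
          * (2 ^ K * ((2 : ℝ≥0∞) ^ K) ^ (-(1 + s)) * g (2 ^ K + 1)) := by
          rw [ENNReal.mul_inv_cancel ht ht', one_mul]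
      _ = _ := by ring

/-- Comparison with the largest of the three; it needs no convexity and holds for all q ≥ 0. -/
theorem add_add_rpow_le {q : ℝ} (hq : 0 ≤ q) (a b c : ℝ≥0∞) :
    (a + b + c) ^ q ≤ 3 ^ q * (a ^ q + b ^ q + c ^ q) := by
  have key : ∀ t : ℝ≥0∞, a ≤ t → b ≤ t → c ≤ t → t ^ q ≤ a ^ q + b ^ q + c ^ q →
      (a + b + c) ^ q ≤ 3 ^ q * (a ^ q + b ^ q + c ^ q) := fun t ha hb hc ht => by
    calc (a + b + c) ^ q ≤ (t + t + t) ^ q := by gcongr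
      _ = 3 ^ q * t ^ q := by rw [← ENNReal.mul_rpow_of_nonneg _ _ hq]; congr 1; ring
      _ ≤ _ := by gcongr
  rcases le_total a b with h | h <;> rcases le_total b c with h' | h'
  · exact key c (h.trans h') h' le_rfl le_add_self
  · exact key b h le_rfl h' (le_add_self.trans le_self_add)
  · rcases le_total a c with h'' | h''
    · exact key c h'' h' le_rfl le_add_self
    · exact key a le_rfl h h'' (le_self_add.trans le_self_add)
  · exact key a le_rfl h (h'.trans h) (le_self_add.trans le_self_add)

/-- The dyadic moment bound rewritten in terms of sums over all integers up to `N`. -/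
theorem exists_dyadic_bound_le {p δ : ℝ} (hp : 2 < p) (hδ : δ ∈ Set.Ioc (0 : ℝ) 1) (C : ℝ≥0) :
    ∃ C' : ℝ≥0, ∀ (N K : ℕ), 2 ^ K ≤ N → ∀ (A v : ℝ≥0∞) (θ : ℕ → ℝ≥0∞),
      2 ^ K * (A ^ (2 * δ / p) + C * ∑ j ∈ Finset.range K, ((2 : ℝ≥0∞) ^ j) ^ (-(2 * δ / p))
          * ((2 ^ j : ℕ) * v + ∑ i ∈ Finset.Icc 2 (2 ^ j + 1), θ i) ^ δ) ^ (1 / (2 * δ / p))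
        ≤ C' * (N * A + N ^ (p / 2) * v ^ (p / 2)
          + N * (∑ k ∈ Finset.Icc 1 N, 1 / (k : ℝ≥0∞) ^ (1 + 2 * δ / p)
            * (∑ i ∈ Finset.Icc 2 k, θ i) ^ δ) ^ (p / (2 * δ))) := by
  have hδ0 := hδ.1
  have hp0 : 0 < p := by linarith
  set s := 2 * δ / p with hs
  have hs0 : 0 < s := by positivity
  -- Since p > 2, the variance part is a geometric sum with ratio greater than 1, dominated by its
  -- last scale.
  have hγ : 0 < δ - s := by
    rw [sub_pos, hs, div_lt_iff₀ hp0]; nlinarith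
  have hq : 0 ≤ 1 / s := by positivity
  obtain ⟨c, hc⟩ := exists_sum_two_pow_rpow_le hγ
  have e1 : p / (2 * δ) = 1 / s := by rw [hs]; field_simp
  set D : ℝ≥0∞ := 1 + (C * c : ℝ≥0∞) ^ (1 / s) + (C * 2 ^ (1 + s) : ℝ≥0∞) ^ (1 / s) with hD
  have hDtop : D ≠ ⊤ := by
    refine ENNReal.add_ne_top.2 ⟨ENNReal.add_ne_top.2 ⟨by simp, ?_⟩, ?_⟩
    · exact ENNReal.rpow_ne_top_of_nonneg hq (ENNReal.mul_ne_top (by simp) (by simp))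
    · exact ENNReal.rpow_ne_top_of_nonneg hq (ENNReal.mul_ne_top (by simp)
        (ENNReal.rpow_ne_top_of_nonneg (by linarith) (by simp)))
  have hEtop : (3 : ℝ≥0∞) ^ (1 / s) * D ≠ ⊤ :=
    ENNReal.mul_ne_top (ENNReal.rpow_ne_top_of_nonneg hq (by simp)) hDtop
  refine ⟨((3 : ℝ≥0∞) ^ (1 / s) * D).toNNReal, fun N K hK A v θ => ?_⟩
  rw [ENNReal.coe_toNNReal hEtop, e1]
  have hKN : (2 : ℝ≥0∞) ^ K ≤ N := by exact_mod_cast hK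
  have hN0 : (N : ℝ≥0∞) ≠ 0 := by
    have := Nat.one_le_two_pow (n := K)
    simp; omega
  have hNt : (N : ℝ≥0∞) ≠ ⊤ := by simp
  set g : ℕ → ℝ≥0∞ := fun k => (∑ i ∈ Finset.Icc 2 k, θ i) ^ δ with hg
  have hgm : Monotone g := fun k l hkl =>
    ENNReal.rpow_le_rpow (Finset.sum_le_sum_of_subset (Finset.Icc_subset_Icc_right hkl)) hδ0.le
  set T := ∑ k ∈ Finset.Icc 1 N, 1 / (k : ℝ≥0∞) ^ (1 + s) * g k with hT
  have hsum : ∑ j ∈ Finset.range K, ((2 : ℝ≥0∞) ^ j) ^ (-s)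
      * ((2 ^ j : ℕ) * v + ∑ i ∈ Finset.Icc 2 (2 ^ j + 1), θ i) ^ δ
      ≤ c * (N : ℝ≥0∞) ^ (δ - s) * v ^ δ + 2 ^ (1 + s) * T := by
    calc _ ≤ ∑ j ∈ Finset.range K, (((2 : ℝ≥0∞) ^ j) ^ (δ - s) * v ^ δ
          + ((2 : ℝ≥0∞) ^ j) ^ (-s) * g (2 ^ j + 1)) := by
          refine Finset.sum_le_sum fun j _ => ?_
          have h2 : ((2 : ℝ≥0∞) ^ j) ≠ 0 := by simp
          have h2' : ((2 : ℝ≥0∞) ^ j) ≠ ⊤ := by simp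
          calc _ ≤ ((2 : ℝ≥0∞) ^ j) ^ (-s) * (((2 ^ j : ℕ) * v) ^ δ + g (2 ^ j + 1)) := by
                gcongr; exact ENNReal.rpow_add_le_add_rpow _ _ hδ0.le hδ.2
            _ = _ := by
                rw [mul_add, ENNReal.mul_rpow_of_nonneg _ _ hδ0.le, ← mul_assoc]
                push_cast
                rw [← ENNReal.rpow_add _ _ h2 h2', neg_add_eq_sub]
      _ = (∑ j ∈ Finset.range K, ((2 : ℝ≥0∞) ^ j) ^ (δ - s)) * v ^ δ
          + ∑ j ∈ Finset.range K, ((2 : ℝ≥0∞) ^ j) ^ (-s) * g (2 ^ j + 1) := by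
          rw [Finset.sum_add_distrib, Finset.sum_mul]
      _ ≤ c * ((2 : ℝ≥0∞) ^ K) ^ (δ - s) * v ^ δ
          + 2 ^ (1 + s) * ∑ k ∈ Finset.Icc (1 : ℕ) (2 ^ K), 1 / (k : ℝ≥0∞) ^ (1 + s) * g k := by
          gcongr
          · exact hc K
          · exact sum_two_pow_rpow_mul_le hs0 hgm K
      _ ≤ _ := by
          gcongr
          exact Finset.sum_le_sum_of_subset (Finset.Icc_subset_Icc_right hK)
  -- The exponent is 1 + (δ - s)/s = δ/s = p/2, the Gaussian order of the variance term.
  have hN1 : (N : ℝ≥0∞) * ((N : ℝ≥0∞) ^ (δ - s)) ^ (1 / s) = (N : ℝ≥0∞) ^ (p / 2) := by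
    rw [← ENNReal.rpow_mul]
    conv_lhs => enter [1]; rw [← ENNReal.rpow_one (N : ℝ≥0∞)]
    rw [← ENNReal.rpow_add _ _ hN0 hNt]
    congr 1
    rw [hs]; field_simp; ring
  have hv1 : (v ^ δ) ^ (1 / s) = v ^ (p / 2) := by
    rw [← ENNReal.rpow_mul]
    congr 1
    rw [hs]; field_simp
  have hA1 : (A ^ s) ^ (1 / s) = A := by
    rw [← ENNReal.rpow_mul, mul_one_div_cancel hs0.ne', ENNReal.rpow_one]
  calc _ ≤ (N : ℝ≥0∞) * (A ^ s + C * c * ((N : ℝ≥0∞) ^ (δ - s) * v ^ δ)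
        + C * 2 ^ (1 + s) * T) ^ (1 / s) := by
        refine mul_le_mul' hKN (ENNReal.rpow_le_rpow ?_ hq)
        calc _ ≤ A ^ s + C * (c * (N : ℝ≥0∞) ^ (δ - s) * v ^ δ + 2 ^ (1 + s) * T) := by gcongr
          _ = _ := by ring
    _ ≤ (N : ℝ≥0∞) * (3 ^ (1 / s) * ((A ^ s) ^ (1 / s)
        + (C * c * ((N : ℝ≥0∞) ^ (δ - s) * v ^ δ)) ^ (1 / s)
        + (C * 2 ^ (1 + s) * T) ^ (1 / s))) := by
        gcongr; exact add_add_rpow_le hq _ _ _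
    _ = 3 ^ (1 / s) * (1 * (N * A) + (C * c : ℝ≥0∞) ^ (1 / s) * (N ^ (p / 2) * v ^ (p / 2))
        + (C * 2 ^ (1 + s) : ℝ≥0∞) ^ (1 / s) * (N * T ^ (1 / s))) := by
        rw [hA1, ENNReal.mul_rpow_of_nonneg (C * c : ℝ≥0∞) _ hq,
          ENNReal.mul_rpow_of_nonneg ((N : ℝ≥0∞) ^ (δ - s)) _ hq, hv1,
          ENNReal.mul_rpow_of_nonneg _ T hq, ← hN1]
        ring
    _ ≤ 3 ^ (1 / s) * (D * (N * A) + D * (N ^ (p / 2) * v ^ (p / 2))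
        + D * (N * T ^ (1 / s))) := by
        gcongr
        · exact le_self_add.trans le_self_add
        · exact le_add_self.trans le_self_add
        · exact le_add_self
    _ = _ := by ring

/-! ### Decomposition of the partial sums and assembly of the bound. -/

theorem sum_Icc_eq_sum_odd_add_sum_even (f : ℤ → ℝ) (n : ℕ) :
    ∑ k ∈ Finset.Icc 1 n, f (k : ℤ) = ∑ l ∈ Finset.range ((n + 1) / 2), f (2 * l + 1)
      + ∑ l ∈ Finset.range (n / 2), f (2 * l + 2) := by
  induction n with
  | zero => simp
  | succ n ih =>
    rw [Finset.sum_Icc_succ_top (by omega), ih]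
    rcases Nat.even_or_odd' n with ⟨t, rfl | rfl⟩
    · rw [show (2 * t + 1) / 2 = t by omega, show (2 * t + 1 + 1) / 2 = t + 1 by omega,
        show 2 * t / 2 = t by omega, Finset.sum_range_succ]
      push_cast; ring
    · rw [show (2 * t + 1 + 1) / 2 = t + 1 by omega, show (2 * t + 1 + 1 + 1) / 2 = t + 1 by omega,
        show (2 * t + 1) / 2 = t by omega, Finset.sum_range_succ _ t, Finset.sum_range_succ _ t]
      push_cast; ring_nf

section

variable {Ω : Type*} {mΩ : MeasurableSpace Ω} {μ : Measure Ω} {Z : ℤ → Ω → ℝ}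

theorem partialSum_eq_blockSum_add (hZ : ∀ i, Measurable (Z i)) (n : ℕ) (ω : Ω) :
    partialSum Z n ω
      = blockSum (fun l => projDiff μ Z hZ (2 * l + 1 + 0)) 0 ((n + 1) / 2) ω
        + blockSum (fun l => projDiff μ Z hZ (2 * l + 1 + 1)) 0 (n / 2) ω
        + ∑ k ∈ Finset.Icc 1 n, (μ[Z (k : ℤ) | shiftFiltration Z hZ (k - 2)]) ω := by
  have h := sum_Icc_eq_sum_odd_add_sum_even (fun i => projDiff μ Z hZ i ω) n
  have e : ∀ k : ℕ, Z (k : ℤ) ω = projDiff μ Z hZ k ω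
      + (μ[Z (k : ℤ) | shiftFiltration Z hZ (k - 2)]) ω := fun k => by simp [projDiff]
  have hS : partialSum Z n ω = ∑ k ∈ Finset.Icc 1 n, (projDiff μ Z hZ k ω
      + (μ[Z (k : ℤ) | shiftFiltration Z hZ (k - 2)]) ω) := Finset.sum_congr rfl fun k _ => e k
  rw [hS, Finset.sum_add_distrib, h]
  have e2 : ∀ l : ℕ, (2 * (l : ℤ) + 1 + 1) = 2 * l + 2 := fun l => by ring
  simp only [blockSum, zero_add, add_zero, Finset.range_eq_Ico, e2]

/-- Markov's inequality, all N conditional means having the same L^1 norm by stationarity. Absolute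
values inside the sum make it dominate the partial sums up to N simultaneously. -/
theorem IsStrictlyStationary.measure_le_sum_abs_condExp_le [IsFiniteMeasure μ]
    (hs : IsStrictlyStationary Z μ) (hZ : ∀ i, Measurable (Z i)) (h1 : Integrable (Z 1) μ)
    (N : ℕ) {y : ℝ} (hy : 0 < y) :
    μ {ω | y ≤ ∑ k ∈ Finset.Icc 1 N, |(μ[Z (k : ℤ) | shiftFiltration Z hZ (k - 2)]) ω|}
      ≤ N / ENNReal.ofReal y * eLpNorm (μ[Z 2 | shiftFiltration Z hZ 0]) 1 μ := by
  have hnorm : ∀ k : ℕ, eLpNorm (μ[Z (k : ℤ) | shiftFiltration Z hZ (k - 2)]) 1 μ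
      = eLpNorm (μ[Z 2 | shiftFiltration Z hZ 0]) 1 μ := fun k => by
    have h := hs.eLpNorm_condExp_shift hZ measurable_id 2 (k - 2)
      ((hs.identDistrib 1 2).integrable_iff.1 h1) 0 1
    simpa using h
  set R : Ω → ℝ := fun ω => ∑ k ∈ Finset.Icc 1 N,
    |(μ[Z (k : ℤ) | shiftFiltration Z hZ (k - 2)]) ω| with hR
  have hRm : AEMeasurable R μ := Finset.aemeasurable_fun_sum _ fun k _ =>
    integrable_condExp.1.aemeasurable.abs
  have hy0 : ENNReal.ofReal y ≠ 0 := by simpa using hy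
  have hsub : {ω | y ≤ R ω} ⊆ {ω | ENNReal.ofReal y ≤ ENNReal.ofReal (R ω)} := fun ω hω =>
    ENNReal.ofReal_le_ofReal hω
  have hint : ∫⁻ ω, ENNReal.ofReal (R ω) ∂μ
      = N * eLpNorm (μ[Z 2 | shiftFiltration Z hZ 0]) 1 μ := by
    have e : ∀ ω, ENNReal.ofReal (R ω)
        = ∑ k ∈ Finset.Icc 1 N, ‖(μ[Z (k : ℤ) | shiftFiltration Z hZ (k - 2)]) ω‖ₑ := fun ω => by
      rw [hR, ENNReal.ofReal_sum_of_nonneg fun _ _ => abs_nonneg _]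
      refine Finset.sum_congr rfl fun k _ => ?_
      rw [← Real.norm_eq_abs, ofReal_norm]
    rw [lintegral_congr e, lintegral_finsetSum' _ fun k _ =>
      integrable_condExp.1.aemeasurable.enorm]
    simp only [← eLpNorm_one_eq_lintegral_enorm, hnorm, Finset.sum_const, Nat.card_Icc,
      add_tsub_cancel_right, nsmul_eq_mul]
  calc _ ≤ μ {ω | ENNReal.ofReal y ≤ ENNReal.ofReal (R ω)} := measure_mono hsub
    _ ≤ (∫⁻ ω, ENNReal.ofReal (R ω) ∂μ) / ENNReal.ofReal y :=
        meas_ge_le_lintegral_div hRm.ennreal_ofReal hy0 ENNReal.ofReal_ne_top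
    _ = _ := by rw [hint, ENNReal.mul_div_right_comm]

theorem exists_measure_blockSum_projDiff_le {p δ : ℝ} (hp : 2 < p) (hδ : δ ∈ Set.Ioc (0 : ℝ) 1)
    (hpδ : δ * (p - 2) ≤ 1) :
    ∃ C : ℝ≥0, ∀ {Ω : Type*} [MeasurableSpace Ω] (μ : Measure Ω) [IsProbabilityMeasure μ]
      (Z : ℤ → Ω → ℝ) (hZ : ∀ i, Measurable (Z i)), IsStrictlyStationary Z μ →
      MemLp (Z 1) (ENNReal.ofReal p) μ →
      ∀ (c : ℤ) (N K : ℕ) (y : ℝ), 2 ^ K ≤ N → 0 < y →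
        μ {ω | ∃ i ≤ 2 ^ K, y ≤ |blockSum (fun l => projDiff μ Z hZ (2 * l + 1 + c)) 0 i ω|}
          ≤ C * (N * (∫⁻ ω, ‖Z 1 ω‖ₑ ^ p ∂μ)
            + N ^ (p / 2) * (∫⁻ ω, ‖Z 1 ω‖ₑ ^ 2 ∂μ) ^ (p / 2)
            + N * (∑ k ∈ Finset.Icc 1 N, 1 / (k : ℝ≥0∞) ^ (1 + 2 * δ / p)
              * (∑ i ∈ Finset.Icc 2 k, sqDependence μ Z hZ (ENNReal.ofReal (p / 2)) (i : ℕ)) ^ δ)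
                ^ (p / (2 * δ))) / ENNReal.ofReal y ^ p := by
  have hp0 : 0 < p := by linarith
  obtain ⟨C', hC'⟩ := exists_dyadic_bound_le hp hδ (rosenthalConst p).toNNReal
  refine ⟨C' * 2 ^ p, fun {Ω} _ μ _ Z hZ hs h1 c N K y hK hy => ?_⟩
  have hd := hs.isMartingaleDifference_projDiff hZ hp h1 c
  refine (hd.measure_exists_le_abs_blockSum_le hp (2 ^ K) hy).trans ?_
  gcongr
  have hM := hd.lintegral_blockSum_two_pow_le hp hδ hpδ
    (fun k => hs.lintegral_projDiff_le hZ hp (2 * k + 1 + c))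
    (fun m j => hs.eLpNorm_condExp_blockSum_sq_le hZ hp h1 c m (2 ^ j)) K 0
  have hN := hC' N K hK (2 ^ p * ∫⁻ ω, ‖Z 1 ω‖ₑ ^ p ∂μ) (∫⁻ ω, ‖Z 1 ω‖ₑ ^ 2 ∂μ)
    (fun i => sqDependence μ Z hZ (ENNReal.ofReal (p / 2)) (i : ℕ))
  refine (hM.trans hN).trans ?_
  have h2 : (1 : ℝ≥0∞) ≤ 2 ^ p := ENNReal.one_le_rpow (by norm_num) hp0
  rw [ENNReal.coe_mul, ENNReal.coe_rpow_of_nonneg _ hp0.le, ENNReal.coe_ofNat,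
    mul_assoc (C' : ℝ≥0∞)]
  -- Only the p-th moment carries the factor 2^p, the price of subtracting the projection; the other
  -- terms are enlarged to share it.
  have key : ∀ M X Y : ℝ≥0∞, N * (2 ^ p * M) + X + Y ≤ 2 ^ p * (N * M + X + Y) := fun M X Y => by
    calc N * (2 ^ p * M) + X + Y = 2 ^ p * (N * M) + 1 * X + 1 * Y := by ring
      _ ≤ 2 ^ p * (N * M) + 2 ^ p * X + 2 ^ p * Y := by gcongr
      _ = _ := by ring
  exact mul_le_mul_right (key _ _ _) _

end

theorem theorem3p1 (r δ : ℝ) (hr : 2 < r) (hδ : δ = min 1 (1 / (r - 2))) :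
    ∃ C : ℝ≥0, ∀ {Ω : Type*} [mΩ : MeasurableSpace Ω] (μ : Measure Ω) [IsProbabilityMeasure μ]
      (G : Filtration ℤ mΩ) (Z : ℤ → Ω → ℝ),
      Adapted G Z → IsStrictlyStationary Z μ →
      ∀ (N : ℕ) (x : ℝ), 0 < x →
        μ {ω | x ≤ maxAbsPartialSum Z N ω} ≤
          C * ((N : ℝ≥0∞) / ENNReal.ofReal x * eLpNorm (μ[Z 2 | G 0]) 1 μ
            + (N : ℝ≥0∞) / ENNReal.ofReal x ^ r * ∫⁻ ω, ‖Z 1 ω‖ₑ ^ r ∂μ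
            + (N : ℝ≥0∞) ^ (r / 2) / ENNReal.ofReal x ^ r * (∫⁻ ω, ‖Z 1 ω‖ₑ ^ 2 ∂μ) ^ (r / 2)
            + (N : ℝ≥0∞) / ENNReal.ofReal x ^ r *
              (∑ k ∈ Finset.Icc 1 N, 1 / (k : ℝ≥0∞) ^ (1 + 2 * δ / r) *
                (∑ i ∈ Finset.Icc 2 k,
                  eLpNorm (fun ω => (μ[fun ω' => Z (i : ℤ) ω' ^ 2 | G 0]) ω
                    - ∫ ω', Z (i : ℤ) ω' ^ 2 ∂μ) (ENNReal.ofReal (r / 2)) μ) ^ δ)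
              ^ (r / (2 * δ))) := by
  have hδ1 : δ ∈ Set.Ioc (0 : ℝ) 1 := by
    rw [hδ]
    exact ⟨lt_min one_pos (one_div_pos.2 (by linarith)), min_le_left _ _⟩
  have hδr : δ * (r - 2) ≤ 1 := by
    have : δ ≤ 1 / (r - 2) := hδ ▸ min_le_right _ _
    rwa [le_div_iff₀ (by linarith)] at this
  have hr0 : 0 < r := by linarith
  obtain ⟨C, hC⟩ := exists_measure_blockSum_projDiff_le hr hδ1 hδr
  -- Each of three pieces is compared with x/3: the remainder contributes 3, each parity class 3^r
  -- C.
  refine ⟨3 + 2 * 3 ^ r * C, fun {Ω} mΩ μ _ G Z hG hs N x hx => ?_⟩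
  have hZ : ∀ i, Measurable (Z i) := fun i => (hG i).mono (G.le i) le_rfl
  rcases Nat.eq_zero_or_pos N with rfl | hN
  · have : {ω | x ≤ maxAbsPartialSum Z 0 ω} = ∅ := by
      ext ω
      simpa [maxAbsPartialSum, partialSum] using hx
    simp [this]
  have hN0 : (N : ℝ≥0∞) ≠ 0 := by simpa using hN.ne'
  have hx0 : ENNReal.ofReal x ≠ 0 := by simpa using hx
  have hxr : ENNReal.ofReal x ^ r ≠ ⊤ := ENNReal.rpow_ne_top_of_nonneg hr0.le ENNReal.ofReal_ne_top
  -- With an infinite r-th moment the right side is infinite, as the constant and N / x^r are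
  -- nonzero.
  rcases eq_or_ne (∫⁻ ω, ‖Z 1 ω‖ₑ ^ r ∂μ) ⊤ with htop | hfin
  · have h1 : (N : ℝ≥0∞) / ENNReal.ofReal x ^ r * ∫⁻ ω, ‖Z 1 ω‖ₑ ^ r ∂μ = ⊤ := by
      rw [htop, ENNReal.mul_top (ENNReal.div_ne_zero.2 ⟨hN0, hxr⟩)]
    rw [h1]
    simp only [add_top, top_add]
    rw [ENNReal.mul_top (by
      rw [ENNReal.coe_ne_zero]; positivity)]
    exact le_top
  have hmem : MemLp (Z 1) (ENNReal.ofReal r) μ := by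
    refine ⟨(hZ 1).aestronglyMeasurable, ?_⟩
    rw [eLpNorm_lt_top_iff_lintegral_rpow_enorm_lt_top (by simpa using hr0) ENNReal.ofReal_ne_top,
      ENNReal.toReal_ofReal hr0.le]
    exact hfin.lt_top
  have hq : 1 ≤ ENNReal.ofReal (r / 2) := by
    rw [show (1 : ℝ≥0∞) = ENNReal.ofReal 1 by simp]; exact ENNReal.ofReal_le_ofReal (by linarith)
  have hint1 := integrable_of_memLp_of_two_lt hr hmem
  have hFG : (shiftFiltration Z hZ 0 : MeasurableSpace Ω) ≤ G 0 := shiftFiltration_le hZ hG 0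
  set y := x / 3 with hy
  have hy0 : 0 < y := by positivity
  -- Each parity class of {1, ..., N} has at most (N+1)/2 ≤ 2^K elements, while 2^K ≤ N keeps the
  -- moment bound within sums up to N.
  set K := Nat.log 2 N with hK
  have hK1 : 2 ^ K ≤ N := Nat.pow_log_le_self 2 hN.ne'
  have hK2 : N < 2 ^ (K + 1) := Nat.lt_pow_succ_log_self (by norm_num) N
  set E : ℤ → Set Ω := fun c => {ω | ∃ i ≤ 2 ^ K,
    y ≤ |blockSum (fun l => projDiff μ Z hZ (2 * l + 1 + c)) 0 i ω|} with hE
  set E' : Set Ω := {ω | y ≤ ∑ k ∈ Finset.Icc 1 N,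
    |(μ[Z (k : ℤ) | shiftFiltration Z hZ (k - 2)]) ω|} with hE'
  have hsub : {ω | x ≤ maxAbsPartialSum Z N ω} ⊆ E 0 ∪ E 1 ∪ E' := by
    intro ω hω
    obtain ⟨i, hi, hxi⟩ := (Finset.le_sup'_iff _).1
      (show x ≤ (Finset.range (N + 1)).sup' _ _ from hω)
    have hiN : i ≤ N := Nat.lt_succ_iff.1 (Finset.mem_range.1 hi)
    by_contra hcon
    simp only [hE, hE', Set.mem_union, Set.mem_ofPred_eq, not_or, not_exists, not_and,
      not_le] at hcon
    have h2K : 2 ^ (K + 1) = 2 * 2 ^ K := pow_succ' 2 K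
    have h0 := hcon.1.1 ((i + 1) / 2) (by omega)
    have h1 := hcon.1.2 (i / 2) (by omega)
    have h2 : |∑ k ∈ Finset.Icc 1 i, (μ[Z (k : ℤ) | shiftFiltration Z hZ (k - 2)]) ω| < y := by
      refine lt_of_le_of_lt ((Finset.abs_sum_le_sum_abs _ _).trans ?_) hcon.2
      exact Finset.sum_le_sum_of_subset_of_nonneg (Finset.Icc_subset_Icc_right hiN)
        fun _ _ _ => abs_nonneg _
    rw [partialSum_eq_blockSum_add (μ := μ) hZ] at hxi
    have h3 := hxi.trans (abs_add_three _ _ _)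
    linarith [show x = 3 * y by rw [hy]; ring]
  set M := ∫⁻ ω, ‖Z 1 ω‖ₑ ^ r ∂μ with hM
  set V := (∫⁻ ω, ‖Z 1 ω‖ₑ ^ 2 ∂μ) ^ (r / 2) with hV
  set T := (∑ k ∈ Finset.Icc 1 N, 1 / (k : ℝ≥0∞) ^ (1 + 2 * δ / r) *
                (∑ i ∈ Finset.Icc 2 k,
                  eLpNorm (fun ω => (μ[fun ω' => Z (i : ℤ) ω' ^ 2 | G 0]) ω
                    - ∫ ω', Z (i : ℤ) ω' ^ 2 ∂μ) (ENNReal.ofReal (r / 2)) μ) ^ δ)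
              ^ (r / (2 * δ)) with hT
  have hδ0 := hδ1.1
  -- The coefficients of the natural filtration are at most those of `G`, once the centring
  -- constants are identified by stationarity.
  have hTle : (∑ k ∈ Finset.Icc 1 N, 1 / (k : ℝ≥0∞) ^ (1 + 2 * δ / r)
      * (∑ i ∈ Finset.Icc 2 k, sqDependence μ Z hZ (ENNReal.ofReal (r / 2)) (i : ℕ)) ^ δ)
        ^ (r / (2 * δ)) ≤ T := by
    rw [hT]
    gcongr with k hk i hi
    have e : ∫ ω', Z (i : ℤ) ω' ^ 2 ∂μ = ∫ ω', Z 1 ω' ^ 2 ∂μ :=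
      ((hs.identDistrib i 1).comp (measurable_id.pow_const 2)).integral_eq
    rw [e]
    exact eLpNorm_condExp_sub_const_le hFG (G.le 0) _ _ hq
  have hE1 : eLpNorm (μ[Z 2 | shiftFiltration Z hZ 0]) 1 μ ≤ eLpNorm (μ[Z 2 | G 0]) 1 μ := by
    simpa using eLpNorm_condExp_sub_const_le (μ := μ) hFG (G.le 0) (Z 2) 0 le_rfl
  have hyx : (ENNReal.ofReal y)⁻¹ = 3 * (ENNReal.ofReal x)⁻¹ := by
    rw [hy, ENNReal.ofReal_div_of_pos (by norm_num), ENNReal.ofReal_ofNat,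
      ENNReal.inv_div (by simp) (by simp), ENNReal.div_eq_inv_mul, mul_comm]
  have hEc : ∀ c, μ (E c) ≤ 3 ^ r * C * (N / ENNReal.ofReal x ^ r * M
      + (N : ℝ≥0∞) ^ (r / 2) / ENNReal.ofReal x ^ r * V + N / ENNReal.ofReal x ^ r * T) := by
    intro c
    refine (hC μ Z hZ hs hmem c N K y hK1 hy0).trans ?_
    rw [ENNReal.div_eq_inv_mul, ← ENNReal.inv_rpow, hyx, ENNReal.mul_rpow_of_nonneg _ _ hr0.le,
      ENNReal.inv_rpow]
    calc _ ≤ 3 ^ r * (ENNReal.ofReal x ^ r)⁻¹ * (C * (N * M + N ^ (r / 2) * V + N * T)) := by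
          gcongr
      _ = _ := by simp only [div_eq_mul_inv]; ring
  have hE'c : μ E' ≤ 3 * (N / ENNReal.ofReal x * eLpNorm (μ[Z 2 | G 0]) 1 μ) := by
    refine (hs.measure_le_sum_abs_condExp_le hZ hint1 N hy0).trans ?_
    rw [div_eq_mul_inv, hyx]
    calc _ ≤ (N : ℝ≥0∞) * (3 * (ENNReal.ofReal x)⁻¹) * eLpNorm (μ[Z 2 | G 0]) 1 μ := by gcongr
      _ = _ := by rw [div_eq_mul_inv]; ring
  set B := (N : ℝ≥0∞) / ENNReal.ofReal x ^ r * M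
      + (N : ℝ≥0∞) ^ (r / 2) / ENNReal.ofReal x ^ r * V + N / ENNReal.ofReal x ^ r * T with hB
  set D := (N : ℝ≥0∞) / ENNReal.ofReal x * eLpNorm (μ[Z 2 | G 0]) 1 μ with hD
  have hcoe : ((3 + 2 * 3 ^ r * C : ℝ≥0) : ℝ≥0∞) = 3 + 2 * 3 ^ r * C := by
    rw [ENNReal.coe_add, ENNReal.coe_mul, ENNReal.coe_mul, ENNReal.coe_rpow_of_nonneg _ hr0.le]
    rfl
  calc μ {ω | x ≤ maxAbsPartialSum Z N ω} ≤ μ (E 0 ∪ E 1 ∪ E') := measure_mono hsub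
    _ ≤ μ (E 0) + μ (E 1) + μ E' :=
        (measure_union_le _ _).trans (add_le_add (measure_union_le _ _) le_rfl)
    _ ≤ 3 ^ r * C * B + 3 ^ r * C * B + 3 * D := add_le_add (add_le_add (hEc 0) (hEc 1)) hE'c
    _ = 3 * D + 2 * 3 ^ r * C * B := by ring
    _ ≤ (3 + 2 * 3 ^ r * C) * D + (3 + 2 * 3 ^ r * C) * B := by
        gcongr
        · exact le_self_add
        · exact le_add_self
    _ = _ := by rw [hcoe, hB]; ring
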